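/- A lattice in $\mathbb{R}^2$ is a discrete additive subgroup that spans $\mathbb{R}^2$ over $\mathbb{R}$. For a family $\mathcal{F}$ of bounded measurable sets in the plane put $$d_+(\mathcal{F})=\limsup_{l\to\infty}\frac{1}{|[-l,l]^2|}\sum_{K\in\mathcal{F},\,K\cap[-l,l]^2\neq\emptyset}|K|,\qquad d_-(\mathcal{F})=\liminf_{l\to\infty}\frac{1}{|[-l,l]^2|}\sum_{K\in\mathcal{F},\,K\subset[-l,l]^2}|K|,$$ where $|\cdot|$ denotes area; $\mathcal{F}$ has density $d$ if $d_+(\mathcal{F})=d_-(\mathcal{F})=d$. For a positive integer $j$, a bounded measurable set $K\subset\mathbb{R}^2$ and a lattice $\Lambda$, the family $K+\Lambda=\{K+v : v\in\Lambda\}$ is a $j$-fold lattice packing if every point of $\mathbb{R}^2$ lies in the interiors of at most $j$ of its members. Let $\delta_L^j(K)$ be the supremum of $d_+(K+\Lambda)$ over all lattices $\Lambda$ for which $K+\Lambda$ is a $j$-fold lattice packing, and let $\Delta_L^j(K)$ be the collection of all lattices $\Lambda$ such that $K+\Lambda$ is a $j$-fold lattice packing with density $\delta_L^j(K)$. Theorem.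 Let $T$ be the triangle with vertices $(0,0)$, $(1,0)$, $(0,1)$, let $j$ be a positive integer and let $\Lambda$ be a lattice in $\mathbb{R}^2$. Then $\Lambda\in\Delta_L^j(T)$ if and only if there is an integer $m$ with $1\le m\le 2j+1$ and $\gcd(m,2j+1)=\gcd(m+1,2j+1)=1$ such that $\Lambda$ is generated by $\left(\frac{1}{2j},\frac{m}{2j}\right)$ and $\left(0,\frac{2j+1}{2j}\right)$. -/

import Mathlib

open MeasureTheory Filter
open scoped ENNReal

noncomputable section

/-- The coordinate plane. Area is the product Lebesgue measure `volume`. -/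
abbrev Plane : Type := ℝ × ℝ

/-- The square `l I²` with `I = [-1, 1]`. -/
def square (l : ℝ) : Set Plane := Set.Icc (-l) l ×ˢ Set.Icc (-l) l

/-- The upper density of a family of sets with respect to a domain `D`:
the total area of the members that meet `D`, divided by the area of `D`. -/
def upperDensityOn {ι : Type*} (F : ι → Set Plane) (D : Set Plane) : ℝ≥0∞ :=
  (∑' i : {i : ι // (F i ∩ D).Nonempty}, volume (F i.1)) / volume D

/-- The lower density of a family of sets with respect to a domain `D`:
the total area of the members contained in `D`, divided by the area of `D`. -/
def lowerDensityOn {ι : Type*} (F : ι → Set Plane) (D : Set Plane) : ℝ≥0∞ :=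
  (∑' i : {i : ι // F i ⊆ D}, volume (F i.1)) / volume D

/-- The upper density of a family of sets in the plane. -/
def upperDensity {ι : Type*} (F : ι → Set Plane) : ℝ≥0∞ :=
  limsup (fun l : ℝ => upperDensityOn F (square l)) atTop

/-- The lower density of a family of sets in the plane. -/
def lowerDensity {ι : Type*} (F : ι → Set Plane) : ℝ≥0∞ :=
  liminf (fun l : ℝ => lowerDensityOn F (square l)) atTop

/-- The family has density `d`: its upper and lower density both equal `d`. -/
def HasDensity {ι : Type*} (F : ι → Set Plane) (d : ℝ≥0∞) : Prop :=
  upperDensity F = d ∧ lowerDensity F = d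

/-- A `j`-fold packing of the plane: a family of measurable bounded sets such that every point
lies in the interiors of at most `j` members. -/
def IsFoldPacking {ι : Type*} (j : ℕ) (F : ι → Set Plane) : Prop :=
  (∀ i, MeasurableSet (F i) ∧ Bornology.IsBounded (F i)) ∧
    ∀ x : Plane, {i : ι | x ∈ interior (F i)}.encard ≤ j

/-- A lattice in the plane: a discrete additive subgroup that spans the plane over `ℝ`. -/
def IsPlaneLattice (Λ : Submodule ℤ Plane) : Prop :=
  DiscreteTopology Λ ∧ Submodule.span ℝ (Λ : Set Plane) = ⊤

/-- The family `K + Λ` of the translates `K + v`, `v ∈ Λ`. -/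
def translates (K : Set Plane) (Λ : Submodule ℤ Plane) (v : Λ) : Set Plane :=
  (fun x : Plane => x + (v : Plane)) '' K

/-- The `j`-fold lattice packing density of `K`: the supremum of the upper densities of
`K + Λ` over all lattices `Λ` for which `K + Λ` is a `j`-fold packing. -/
def latticePackingDensity (j : ℕ) (K : Set Plane) : ℝ≥0∞ :=
  ⨆ (Λ : Submodule ℤ Plane) (_ : IsPlaneLattice Λ) (_ : IsFoldPacking j (translates K Λ)),
    upperDensity (translates K Λ)

/-- The collection of the lattices `Λ` such that `K + Λ` is a `j`-fold packing whose density is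
the `j`-fold lattice packing density of `K`. -/
def optimalPackingLattices (j : ℕ) (K : Set Plane) : Set (Submodule ℤ Plane) :=
  {Λ | IsPlaneLattice Λ ∧ IsFoldPacking j (translates K Λ) ∧
    HasDensity (translates K Λ) (latticePackingDensity j K)}

/-- The triangle with vertices `(0,0)`, `(1,0)` and `(0,1)`. -/
def triangle : Set Plane := convexHull ℝ {(0, 0), (1, 0), (0, 1)}

end

/-!
Density of `K + Λ` is area over covolume (`HasCovolume.hasDensity`), so the claim is that a lattice
`j`-fold packing of the triangle has covolume at least `(2 j + 1) / (2 j) ^ 2`, and that equality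
singles out the listed lattices. Everything is scaled by `2 j`: the triangle gets legs `2 j`, the
bound becomes `2 j + 1`, and the extremal lattices are generated by `(1, m)` and `(0, 2 j + 1)`.

*Lower bound.* In every class modulo the lattice `L` keep the first `j` points of the quadrant
`x, y ≥ 0`, ordered by `x + y` and then by `x`. The resulting region (`lowRegion`) has area at most
`j` times the covolume and contains the triangle (`mem_lowRegion_of_packing`). It is a staircase:
a point is outside iff at least `j` positive lattice vectors lie below it coordinatewise. The
heights of its steps are ordinates of lattice vectors, and only the first `j` vectors of the left
half plane and the first `j` vectors of the open quadrant can contribute (`exists_stepHeight`),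
so there are at most `2 j` heights. A staircase with at most `n = 2 j` heights that contains the
triangle with legs `n` has area at least `n (n + 1) / 2` (`volume_unblockedRegion_ge`): of the unit
strip above the hypotenuse, each height blocks at most a triangle of area `1 / 2`.

*Equality.* If the bound is attained, the blocked triangles do not overlap and lie in the strip, so
the heights are `1, ..., 2 j` (`exists_int_eq_of_minimal`), and the translates of the staircase of
unit cells form an exact `j`-fold tiling (`HasCovolume.staircase_encard_eq`). In such a tiling
right edges of the staircase are continued by left edges of translates (`exists_leftEdge`). This
yields a vector `(1, s)` and, from the first multiple of `s + 1` beyond `2 j`, a short vertical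
vector; an area comparison then shows that `(1, s)` and `(0, 2 j + 1)` generate `L`
(`HasCovolume.eq_span_of_exact`). Exchanging the coordinates makes `s` an integer and gives the
coprimality conditions.

*Converse.* For the listed lattices, the lattice points in a translate of the open triangle are
counted by a carry argument modulo `2 j + 1` (`card_filter_val_add_val_le`).
-/

/-! ### Lattices in the plane and their covolume -/

/-- `L` is a lattice of covolume `D`, encoded by a generating pair of vectors whose determinant has
absolute value `D > 0`. -/
def HasCovolume (L : Submodule ℤ Plane) (D : ℝ) : Prop :=
  ∃ u w : Plane, L = Submodule.span ℤ {u, w} ∧ |u.1 * w.2 - u.2 * w.1| = D ∧ 0 < D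

theorem exists_basis_of_det_ne_zero {u w : Plane} (h : u.1 * w.2 - u.2 * w.1 ≠ 0) :
    ∃ b : Module.Basis (Fin 2) ℝ Plane, ⇑b = ![u, w] := by
  have hli : LinearIndependent ℝ ![u, w] := by
    rw [LinearIndependent.pair_iff]
    intro s t hst
    have h1 : s * u.1 + t * w.1 = 0 := by simpa using congrArg Prod.fst hst
    have h2 : s * u.2 + t * w.2 = 0 := by simpa using congrArg Prod.snd hst
    constructor
    · have : s * (u.1 * w.2 - u.2 * w.1) = 0 := by linear_combination w.2 * h1 - w.1 * h2
      exact (mul_eq_zero.mp this).resolve_right h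
    · have : t * (u.1 * w.2 - u.2 * w.1) = 0 := by linear_combination u.1 * h2 - u.2 * h1
      exact (mul_eq_zero.mp this).resolve_right h
  exact ⟨basisOfLinearIndependentOfCardEqFinrank hli (by simp), by simp⟩

theorem finTwoProd_det (b : Fin 2 → Plane) :
    (Module.Basis.finTwoProd ℝ).det b = (b 0).1 * (b 1).2 - (b 0).2 * (b 1).1 := by
  rw [Module.Basis.det_apply, Matrix.det_fin_two]
  simp [Module.Basis.toMatrix_apply]
  ring

theorem volume_fundamentalDomain_finTwoProd :
    volume (ZSpan.fundamentalDomain (Module.Basis.finTwoProd ℝ)) = 1 := by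
  have : ZSpan.fundamentalDomain (Module.Basis.finTwoProd ℝ)
      = Set.Ico (0 : ℝ) 1 ×ˢ Set.Ico (0 : ℝ) 1 := by
    ext x
    simp [ZSpan.mem_fundamentalDomain, Fin.forall_fin_two]
  rw [this, Measure.volume_eq_prod, Measure.prod_prod]
  simp

theorem volume_fundamentalDomain_plane (b : Module.Basis (Fin 2) ℝ Plane) :
    volume (ZSpan.fundamentalDomain b)
      = ENNReal.ofReal |(b 0).1 * (b 1).2 - (b 0).2 * (b 1).1| := by
  rw [ZSpan.measure_fundamentalDomain b volume (Module.Basis.finTwoProd ℝ),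
    volume_fundamentalDomain_finTwoProd, finTwoProd_det, mul_one]

theorem HasCovolume.exists_basis {L : Submodule ℤ Plane} {D : ℝ} (h : HasCovolume L D) :
    ∃ b : Module.Basis (Fin 2) ℝ Plane, L = Submodule.span ℤ (Set.range b) ∧
      volume (ZSpan.fundamentalDomain b) = ENNReal.ofReal D := by
  obtain ⟨u, w, hL, hD, hpos⟩ := h
  obtain ⟨b, hb⟩ := exists_basis_of_det_ne_zero (u := u) (w := w) (by
    intro h0; rw [h0, abs_zero] at hD; exact hpos.ne hD)
  refine ⟨b, ?_, ?_⟩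
  · rw [hL, hb]; simp [Matrix.range_cons, Set.pair_comm]
  · rw [volume_fundamentalDomain_plane, hb]; simp [← hD]

theorem HasCovolume.isPlaneLattice {L : Submodule ℤ Plane} {D : ℝ} (h : HasCovolume L D) :
    IsPlaneLattice L := by
  obtain ⟨b, rfl, -⟩ := h.exists_basis
  exact ⟨inferInstance, ZSpan.span_top b⟩

theorem IsPlaneLattice.exists_hasCovolume {L : Submodule ℤ Plane} (h : IsPlaneLattice L) :
    ∃ D, HasCovolume L D := by
  have := h.1
  have : IsZLattice ℝ L := ⟨h.2⟩
  have hfin : Module.Finite ℤ L := ZLattice.module_finite ℝ L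
  have hfree : Module.Free ℤ L := ZLattice.module_free ℝ L
  have hr : Module.finrank ℤ L = 2 := by rw [ZLattice.rank ℝ L]; simp
  let b : Module.Basis (Fin 2) ℤ L := Module.finBasisOfFinrankEq ℤ L hr
  let B := b.ofZLatticeBasis ℝ
  have hB : Submodule.span ℤ (Set.range B) = L := b.ofZLatticeBasis_span ℝ
  refine ⟨_, B 0, B 1, ?_, rfl, ?_⟩
  · rw [← hB]; congr 1
    ext x; simp [Fin.exists_fin_two, eq_comm]
  · have h0 := ZSpan.measure_fundamentalDomain_ne_zero B (μ := volume)
    rw [volume_fundamentalDomain_plane] at h0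
    simpa using h0

theorem HasCovolume.finite_of_bounded {L : Submodule ℤ Plane} {D : ℝ} (h : HasCovolume L D)
    {s : Set Plane} (hs : ∀ v ∈ s, v ∈ L) (hb : Bornology.IsBounded s) : s.Finite := by
  obtain ⟨b, rfl, -⟩ := h.exists_basis
  exact (ZSpan.setFinite_inter b hb).subset fun v hv => ⟨hv, hs v hv⟩

theorem HasCovolume.pos {L : Submodule ℤ Plane} {D : ℝ} (h : HasCovolume L D) : 0 < D := by
  obtain ⟨_, _, _, _, h⟩ := h
  exact h

/-- An integral over the plane is the integral over a fundamental domain of the sum over `L`. -/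
theorem HasCovolume.lintegral {L : Submodule ℤ Plane} {D : ℝ} (h : HasCovolume L D) :
    ∃ P : Set Plane, volume P = ENNReal.ofReal D ∧ ∀ f : Plane → ℝ≥0∞, Measurable f →
      ∫⁻ x, f x = ∫⁻ p in P, ∑' v : L, f (p - v) := by
  obtain ⟨b, rfl, hv⟩ := h.exists_basis
  refine ⟨_, hv, fun f hf => ?_⟩
  have h' := ZSpan.isAddFundamentalDomain b (volume : Measure Plane)
  have : VAddInvariantMeasure (Submodule.span ℤ (Set.range b)) Plane volume :=
    inferInstanceAs <|
      VAddInvariantMeasure (Submodule.span ℤ (Set.range b)).toAddSubgroup Plane volume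
  rw [h'.lintegral_eq_tsum' f, lintegral_tsum]
  · congr 1
    ext v
    congr 1
    ext p
    rw [Submodule.vadd_def, vadd_eq_add, Submodule.coe_neg, sub_eq_add_neg, add_comm]
  · intro v
    exact (hf.comp (measurable_id.sub_const _)).aemeasurable

/-- If the translates of `f` along `L` sum up to at most `k` at every point, then `∫ f ≤ k D`. -/
theorem HasCovolume.lintegral_le {L : Submodule ℤ Plane} {D : ℝ} (h : HasCovolume L D)
    {f : Plane → ℝ≥0∞} (hf : Measurable f) {k : ℝ≥0∞} (hk : ∀ p, ∑' v : L, f (p - v) ≤ k) :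
    ∫⁻ x, f x ≤ k * ENNReal.ofReal D := by
  obtain ⟨P, hP, hint⟩ := h.lintegral
  rw [hint f hf, ← hP]
  calc _ ≤ ∫⁻ _ in P, k := lintegral_mono fun p => hk p
    _ = _ := by simp

theorem HasCovolume.le_lintegral {L : Submodule ℤ Plane} {D : ℝ} (h : HasCovolume L D)
    {f : Plane → ℝ≥0∞} (hf : Measurable f) {k : ℝ≥0∞} (hk : ∀ p, k ≤ ∑' v : L, f (p - v)) :
    k * ENNReal.ofReal D ≤ ∫⁻ x, f x := by
  obtain ⟨P, hP, hint⟩ := h.lintegral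
  rw [hint f hf, ← hP]
  calc _ = ∫⁻ _ in P, k := by simp
    _ ≤ _ := lintegral_mono fun p => hk p

theorem tsum_indicator_translates (L : Submodule ℤ Plane) (S : Set Plane) (p : Plane) :
    ∑' v : L, S.indicator (1 : Plane → ℝ≥0∞) (p - v)
      = ({v | v ∈ L ∧ p - v ∈ S} : Set Plane).encard := by
  have h1 : ∀ v : L, S.indicator (1 : Plane → ℝ≥0∞) (p - v)
      = ({v : L | p - (v : Plane) ∈ S} : Set L).indicator (1 : L → ℝ≥0∞) v := by
    intro v
    by_cases hv : p - (v : Plane) ∈ S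
    · rw [Set.indicator_of_mem hv, Set.indicator_of_mem (by exact hv)]; rfl
    · rw [Set.indicator_of_notMem hv, Set.indicator_of_notMem (by exact hv)]
  rw [tsum_congr h1]
  rw [← tsum_subtype ({v : L | p - (v : Plane) ∈ S} : Set L) (1 : L → ℝ≥0∞)]
  have h2 := ENNReal.tsum_set_one ({v : L | p - (v : Plane) ∈ S} : Set L)
  change ∑' _ : ({v : L | p - (v : Plane) ∈ S} : Set L), (1 : ℝ≥0∞) = _
  rw [h2]
  congr 1
  have : ({v | v ∈ L ∧ p - v ∈ S} : Set Plane)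
      = (Subtype.val : L → Plane) '' {v : L | p - (v : Plane) ∈ S} := by
    ext v; simp [and_comm]
  rw [this, Subtype.val_injective.encard_image]

/-- If the translates of `S` along `L` cover every point at most `k` times, then `|S| ≤ k D`. -/
theorem HasCovolume.volume_le {L : Submodule ℤ Plane} {D : ℝ} (h : HasCovolume L D)
    {S : Set Plane} (hS : MeasurableSet S) {k : ℕ}
    (hk : ∀ p, ({v | v ∈ L ∧ p - v ∈ S} : Set Plane).encard ≤ k) :
    volume S ≤ k * ENNReal.ofReal D := by
  rw [← lintegral_indicator_one hS]
  refine h.lintegral_le (measurable_one.indicator hS) fun p => ?_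
  rw [tsum_indicator_translates]
  exact_mod_cast ENat.toENNReal_le.mpr (hk p)

/-- If the translates of `S` along `L` cover every point at least `k` times, then `k D ≤ |S|`. -/
theorem HasCovolume.le_volume {L : Submodule ℤ Plane} {D : ℝ} (h : HasCovolume L D)
    {S : Set Plane} (hS : MeasurableSet S) {k : ℕ}
    (hk : ∀ p, (k : ℕ∞) ≤ ({v | v ∈ L ∧ p - v ∈ S} : Set Plane).encard) :
    k * ENNReal.ofReal D ≤ volume S := by
  rw [← lintegral_indicator_one hS]
  refine h.le_lintegral (measurable_one.indicator hS) fun p => ?_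
  rw [tsum_indicator_translates]
  exact_mod_cast ENat.toENNReal_le.mpr (hk p)

/-! ### The density of a family of lattice translates -/

theorem volume_square {l : ℝ} (hl : 0 ≤ l) : volume (square l) = ENNReal.ofReal (4 * l ^ 2) := by
  rw [square, Measure.volume_eq_prod, Measure.prod_prod, Real.volume_Icc,
    ← ENNReal.ofReal_mul (by linarith)]
  congr 1; ring

theorem mem_square {l : ℝ} {x : Plane} : x ∈ square l ↔ |x.1| ≤ l ∧ |x.2| ≤ l := by
  simp only [square, Set.mem_prod, Set.mem_Icc, abs_le]

theorem upperDensityOn_translates (K D : Set Plane) (Λ : Submodule ℤ Plane) :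
    upperDensityOn (translates K Λ) D
      = ({i : Λ | (translates K Λ i ∩ D).Nonempty}.encard : ℝ≥0∞) * volume K / volume D := by
  have h : ∀ i, volume (translates K Λ i) = volume K := by
    intro i
    simp only [translates, Set.image_add_right, measure_preimage_add_right]
  unfold upperDensityOn
  simp_rw [h]
  congr 1
  exact ENNReal.tsum_set_const _ _

theorem lowerDensityOn_translates (K D : Set Plane) (Λ : Submodule ℤ Plane) :
    lowerDensityOn (translates K Λ) D
      = ({i : Λ | translates K Λ i ⊆ D}.encard : ℝ≥0∞) * volume K / volume D := by
  have h : ∀ i, volume (translates K Λ i) = volume K := by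
    intro i
    simp only [translates, Set.image_add_right, measure_preimage_add_right]
  unfold lowerDensityOn
  simp_rw [h]
  congr 1
  exact ENNReal.tsum_set_const _ _

open scoped Pointwise in
/-- Comparison of the number of lattice points in an index set with areas, by means of the
translates of a bounded fundamental domain; `R` bounds the norm on that domain. -/
theorem HasCovolume.exists_count_bounds {L : Submodule ℤ Plane} {D : ℝ} (h : HasCovolume L D) :
    ∃ R : ℝ, 0 ≤ R ∧
      (∀ (I : Set L) (A : Set Plane), (∀ v ∈ I, ∀ p : Plane, |p.1 - (v : Plane).1| ≤ R →
          |p.2 - (v : Plane).2| ≤ R → p ∈ A) →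
        (I.encard : ℝ≥0∞) * ENNReal.ofReal D ≤ volume A) ∧
      (∀ (I : Set L) (A : Set Plane), (∀ v : L, ∀ p ∈ A, |p.1 - (v : Plane).1| ≤ R →
          |p.2 - (v : Plane).2| ≤ R → v ∈ I) →
        volume A ≤ (I.encard : ℝ≥0∞) * ENNReal.ofReal D) := by
  obtain ⟨b, rfl, hv⟩ := h.exists_basis
  obtain ⟨R, hR0, hR⟩ := (ZSpan.fundamentalDomain_isBounded b).exists_pos_norm_le
  set P := ZSpan.fundamentalDomain b with hP
  set L := Submodule.span ℤ (Set.range b)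
  have hfd := ZSpan.isAddFundamentalDomain b (volume : Measure Plane)
  have : VAddInvariantMeasure L Plane volume :=
    inferInstanceAs <| VAddInvariantMeasure L.toAddSubgroup Plane volume
  have hcoord : ∀ v : L, ∀ p ∈ v +ᵥ P,
      |p.1 - (v : Plane).1| ≤ R ∧ |p.2 - (v : Plane).2| ≤ R := by
    rintro v _ ⟨q, hq, rfl⟩
    have hq' := hR q hq
    rw [Prod.norm_def] at hq'
    have h1 := (le_max_left _ _).trans hq'
    have h2 := (le_max_right _ _).trans hq'
    simp only [vadd_eq_add, Prod.fst_add, Prod.snd_add, add_sub_cancel_left]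
    exact ⟨h1, h2⟩
  have hvol : ∀ v : L, volume (v +ᵥ P) = ENNReal.ofReal D := by
    intro v
    rw [measure_vadd, hv]
  have hmeas : ∀ v : L, NullMeasurableSet (v +ᵥ P) volume := fun v => hfd.nullMeasurableSet_vadd v
  have hsum : ∀ I : Set L, ∑' v : I, volume ((v : L) +ᵥ P)
      = (I.encard : ℝ≥0∞) * ENNReal.ofReal D := by
    intro I
    simp_rw [hvol]
    exact ENNReal.tsum_set_const _ _
  refine ⟨R, hR0.le, ?_, ?_⟩
  · intro I A hIA
    rw [← hsum, ← measure_iUnion₀]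
    · refine measure_mono (Set.iUnion_subset ?_)
      intro v p hp
      exact hIA v v.2 p (hcoord v p hp).1 (hcoord v p hp).2
    · intro v w hvw
      exact hfd.aedisjoint (fun h => hvw (Subtype.ext h))
    · exact fun v => hmeas v
  · intro I A hIA
    rw [← hsum]
    refine (measure_mono ?_).trans (measure_iUnion_le _)
    intro p hp
    obtain ⟨v, hv, -⟩ := ZSpan.exist_unique_vadd_mem_fundamentalDomain b p
    have hp' : p ∈ (-v) +ᵥ P := by
      exact ⟨v +ᵥ p, hv, neg_vadd_vadd v p⟩
    exact Set.mem_iUnion.mpr ⟨⟨-v, hIA _ p hp (hcoord _ p hp').1 (hcoord _ p hp').2⟩, hp'⟩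

theorem tendsto_volume_square_ratio (c : ℝ) :
    Tendsto (fun l : ℝ => volume (square (l + c)) / volume (square l)) atTop (nhds 1) := by
  have h1 : Tendsto (fun l : ℝ => ENNReal.ofReal ((1 + c * l⁻¹) ^ 2)) atTop (nhds 1) := by
    have : Tendsto (fun l : ℝ => (1 + c * l⁻¹) ^ 2) atTop (nhds ((1 + c * 0) ^ 2)) :=
      ((tendsto_inv_atTop_zero.const_mul c).const_add 1).pow 2
    simpa using ENNReal.tendsto_ofReal this
  refine h1.congr' ?_
  filter_upwards [eventually_gt_atTop 0, eventually_ge_atTop (-c)] with l hl hlc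
  rw [volume_square hl.le, volume_square (by linarith), ← ENNReal.ofReal_div_of_pos (by positivity)]
  congr 1
  field_simp

/-- The density of a family of lattice translates is area over covolume. -/
theorem HasCovolume.hasDensity {L : Submodule ℤ Plane} {D : ℝ} (h : HasCovolume L D)
    {K : Set Plane} (hK : Bornology.IsBounded K) (hne : K.Nonempty) :
    HasDensity (translates K L) (volume K / ENNReal.ofReal D) := by
  obtain ⟨R, hR0, hup, hlow⟩ := h.exists_count_bounds
  obtain ⟨r, hr0, hr⟩ := hK.exists_pos_norm_le
  have hr' : ∀ x ∈ K, |x.1| ≤ r ∧ |x.2| ≤ r := by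
    intro x hx
    have := hr x hx
    rw [Prod.norm_def] at this
    exact ⟨(le_max_left _ _).trans this, (le_max_right _ _).trans this⟩
  have hD0 : ENNReal.ofReal D ≠ 0 := by simpa using h.pos
  have hKtop : volume K ≠ ∞ := hK.measure_lt_top.ne
  set d := volume K / ENNReal.ofReal D with hd
  have hdtop : d ≠ ∞ := ENNReal.div_ne_top hKtop hD0
  -- every translate that meets the square lies in a slightly larger square
  have hU : ∀ l, upperDensityOn (translates K L) (square l)
      ≤ d * (volume (square (l + (r + R))) / volume (square l)) := by
    intro l
    rw [upperDensityOn_translates]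
    have := hup {i : L | (translates K L i ∩ square l).Nonempty} (square (l + (r + R))) (by
      rintro v ⟨_, ⟨x, hx, rfl⟩, hx2⟩ p hp1 hp2
      have hx3 := hr' x hx
      rw [mem_square] at hx2 ⊢
      simp only [Prod.fst_add, Prod.snd_add, abs_le] at *
      constructor <;> constructor <;> linarith [hx2.1.1, hx2.1.2, hx2.2.1, hx2.2.2])
    rw [← mul_div_assoc]
    refine ENNReal.div_le_div_right ?_ _
    rw [hd, mul_comm, mul_comm (_ / _), ← mul_div_assoc, mul_comm _ (volume K), mul_div_assoc]
    refine mul_le_mul_right ?_ _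
    rw [ENNReal.le_div_iff_mul_le (Or.inl hD0) (Or.inl ENNReal.ofReal_ne_top)]
    exact this
  -- translates whose cell meets a slightly smaller square are contained in the square
  have hLo : ∀ l, d * (volume (square (l + (-(r + R)))) / volume (square l))
      ≤ lowerDensityOn (translates K L) (square l) := by
    intro l
    rw [lowerDensityOn_translates]
    have := hlow {i : L | translates K L i ⊆ square l} (square (l + (-(r + R)))) (by
      rintro v p hp hp1 hp2 _ ⟨x, hx, rfl⟩
      have hx3 := hr' x hx
      rw [mem_square] at hp ⊢
      simp only [Prod.fst_add, Prod.snd_add, abs_le] at *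
      constructor <;> constructor <;> linarith [hp.1.1, hp.1.2, hp.2.1, hp.2.2])
    rw [← mul_div_assoc]
    refine ENNReal.div_le_div_right ?_ _
    rw [hd, mul_comm, ← mul_div_assoc, mul_comm _ (volume K), mul_div_assoc,
      mul_comm (_ : ℝ≥0∞) (volume K)]
    refine mul_le_mul_right ?_ _
    rw [ENNReal.div_le_iff hD0 ENNReal.ofReal_ne_top]
    exact this
  have hlim : ∀ c, Tendsto (fun l : ℝ => d * (volume (square (l + c)) / volume (square l)))
      atTop (nhds d) := by
    intro c
    have := ENNReal.Tendsto.const_mul (tendsto_volume_square_ratio c) (a := d) (Or.inr hdtop)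
    simpa using this
  have hLU : ∀ l, lowerDensityOn (translates K L) (square l)
      ≤ upperDensityOn (translates K L) (square l) := by
    intro l
    rw [lowerDensityOn_translates, upperDensityOn_translates]
    gcongr
    intro hsub
    obtain ⟨x, hx⟩ := hne
    exact ⟨_, ⟨x, hx, rfl⟩, hsub ⟨x, hx, rfl⟩⟩
  have hlo := tendsto_of_tendsto_of_tendsto_of_le_of_le (hlim (-(r + R))) (hlim (r + R)) hLo
    (fun l => (hLU l).trans (hU l))
  have hhi := tendsto_of_tendsto_of_tendsto_of_le_of_le (hlim (-(r + R))) (hlim (r + R))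
    (fun l => (hLo l).trans (hLU l)) hU
  exact ⟨hhi.limsup_eq, hlo.liminf_eq⟩

/-! ### The triangle and some areas -/

theorem triangle_eq : triangle = {x : Plane | 0 ≤ x.1 ∧ 0 ≤ x.2 ∧ x.1 + x.2 ≤ 1} := by
  apply Set.Subset.antisymm
  · refine convexHull_min ?_ ?_
    · rintro x (rfl | rfl | rfl) <;> norm_num
    · rintro x ⟨hx1, hx2, hx3⟩ y ⟨hy1, hy2, hy3⟩ a b ha hb hab
      simp only [Set.mem_ofPred_eq, Prod.fst_add, Prod.snd_add, Prod.smul_fst, Prod.smul_snd,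
        smul_eq_mul]
      refine ⟨by positivity, by positivity, ?_⟩
      calc a * x.1 + b * y.1 + (a * x.2 + b * y.2)
          = a * (x.1 + x.2) + b * (y.1 + y.2) := by ring
        _ ≤ a * 1 + b * 1 := by gcongr
        _ = 1 := by linarith
  · rintro ⟨x, y⟩ ⟨hx, hy, hxy⟩
    simp only at hx hy hxy
    have hconv := convex_convexHull ℝ ({(0, 0), (1, 0), (0, 1)} : Set Plane)
    have hs : ({(0, 0), (1, 0), (0, 1)} : Set Plane) ⊆ triangle := subset_convexHull ℝ _
    have := hconv.sum_mem (t := Finset.univ) (w := ![1 - x - y, x, y])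
      (z := ![((0, 0) : Plane), (1, 0), (0, 1)])
      (by intro i _; fin_cases i <;> simp <;> linarith)
      (by simp [Fin.sum_univ_three]; ring)
      (by intro i _; fin_cases i <;> exact hs (by simp))
    rw [triangle]
    simpa [Fin.sum_univ_three] using this

theorem interior_triangle :
    interior triangle = {x : Plane | 0 < x.1 ∧ 0 < x.2 ∧ x.1 + x.2 < 1} := by
  apply Set.Subset.antisymm
  · intro x hx
    rw [mem_interior_iff_mem_nhds, Metric.mem_nhds_iff] at hx
    obtain ⟨ε, hε, hb⟩ := hx
    rw [triangle_eq] at hb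
    have key : ∀ s : ℝ, |s| = ε / 2 → (x.1 + s, x.2 + s) ∈ Metric.ball x ε := by
      intro s hs
      rw [Metric.mem_ball, Prod.dist_eq, Real.dist_eq, Real.dist_eq]
      simp only [add_sub_cancel_left, hs, max_self]
      linarith
    have h1 := hb (key (ε / 2) (abs_of_pos (by linarith)))
    have h2 := hb (key (-(ε / 2)) (by rw [abs_neg, abs_of_pos (by linarith)]))
    obtain ⟨_, _, h1⟩ := h1
    obtain ⟨h2, h3, _⟩ := h2
    simp only at h1 h2 h3
    exact ⟨by linarith, by linarith, by linarith⟩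
  · refine interior_maximal ?_ ?_
    · rw [triangle_eq]
      rintro x ⟨h1, h2, h3⟩
      exact ⟨h1.le, h2.le, h3.le⟩
    · exact ((isOpen_lt continuous_const continuous_fst).inter
        ((isOpen_lt continuous_const continuous_snd).inter
          (isOpen_lt (continuous_fst.add continuous_snd) continuous_const)))

theorem isBounded_triangle : Bornology.IsBounded triangle := by
  refine (Metric.isBounded_Icc ((0, 0) : Plane) (1, 1)).subset ?_
  rw [triangle_eq]
  rintro x ⟨h1, h2, h3⟩
  exact ⟨⟨h1, h2⟩, ⟨by linarith, by linarith⟩⟩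

theorem measurableSet_triangle : MeasurableSet triangle := by
  rw [triangle_eq]
  exact ((isClosed_le continuous_const continuous_fst).inter
        ((isClosed_le continuous_const continuous_snd).inter
          (isClosed_le (continuous_fst.add continuous_snd) continuous_const))).measurableSet

theorem volume_triangle_ne_zero : volume triangle ≠ 0 := by
  have h : (0 : ℝ≥0∞) < volume (interior triangle) := by
    refine isOpen_interior.measure_pos volume ⟨(1 / 4, 1 / 4), ?_⟩
    rw [interior_triangle]
    norm_num
  exact (h.trans_le (measure_mono interior_subset)).ne'

/-- The packing condition for the triangle in terms of the difference of a point and the lattice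
points. -/
theorem isFoldPacking_triangle_iff (j : ℕ) (Λ : Submodule ℤ Plane) :
    IsFoldPacking j (translates triangle Λ) ↔ ∀ x : Plane,
      ({v | v ∈ Λ ∧ (0 < x.1 - v.1 ∧ 0 < x.2 - v.2 ∧ x.1 - v.1 + (x.2 - v.2) < 1)} :
        Set Plane).encard ≤ j := by
  have hint : ∀ (v : Λ) (x : Plane), x ∈ interior (translates triangle Λ v) ↔
      (0 < x.1 - (v : Plane).1 ∧ 0 < x.2 - (v : Plane).2 ∧
        x.1 - (v : Plane).1 + (x.2 - (v : Plane).2) < 1) := by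
    intro v x
    have h1 : interior (translates triangle Λ v)
        = (fun y : Plane => y + (v : Plane)) '' interior triangle :=
      ((Homeomorph.addRight (v : Plane)).image_interior triangle).symm
    rw [h1, interior_triangle]
    simp only [Set.image_add_right, Set.mem_preimage, Set.mem_ofPred_eq, ← sub_eq_add_neg]
    rfl
  have henc : ∀ x : Plane, {i : Λ | x ∈ interior (translates triangle Λ i)}.encard
      = ({v | v ∈ Λ ∧ (0 < x.1 - v.1 ∧ 0 < x.2 - v.2 ∧ x.1 - v.1 + (x.2 - v.2) < 1)} :
        Set Plane).encard := by
    intro x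
    rw [← Subtype.val_injective.encard_image]
    congr 1
    ext v
    constructor
    · rintro ⟨v, hv, rfl⟩
      exact ⟨v.2, (hint v x).mp hv⟩
    · rintro ⟨hv, h⟩
      exact ⟨⟨v, hv⟩, (hint ⟨v, hv⟩ x).mpr h, rfl⟩
  unfold IsFoldPacking
  simp_rw [henc]
  refine and_iff_right fun i => ⟨?_, ?_⟩
  · exact (measurableEmbedding_addRight (i : Plane)).measurableSet_image.mpr measurableSet_triangle
  · obtain ⟨r, hr⟩ := isBounded_triangle.exists_norm_le
    refine isBounded_iff_forall_norm_le.mpr ⟨r + ‖(i : Plane)‖, ?_⟩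
    rintro _ ⟨x, hx, rfl⟩
    exact (norm_add_le _ _).trans (by gcongr; exact hr x hx)

/-- The half-open triangle with legs of length `s` parallel to the axes and right angle at
`(a, b)`. -/
def halfOpenTriangle (a b s : ℝ) : Set Plane :=
  {x | a ≤ x.1 ∧ b ≤ x.2 ∧ x.1 + x.2 < a + b + s}

theorem measurableSet_halfOpenTriangle (a b s : ℝ) : MeasurableSet (halfOpenTriangle a b s) :=
  (measurableSet_le measurable_const measurable_fst).inter
    ((measurableSet_le measurable_const measurable_snd).inter
      (measurableSet_lt (measurable_fst.add measurable_snd) measurable_const))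

theorem volume_halfOpenTriangle (a b : ℝ) {s : ℝ} (hs : 0 ≤ s) :
    volume (halfOpenTriangle a b s) = ENNReal.ofReal (s ^ 2 / 2) := by
  rw [Measure.volume_eq_prod, Measure.prod_apply (measurableSet_halfOpenTriangle a b s)]
  have h1 : ∀ x : ℝ, volume (Prod.mk x ⁻¹' halfOpenTriangle a b s)
      = (Set.Icc a (a + s)).indicator (fun x => ENNReal.ofReal (s - (x - a))) x := by
    intro x
    by_cases hx : x ∈ Set.Icc a (a + s)
    · rw [Set.indicator_of_mem hx]
      have : Prod.mk x ⁻¹' halfOpenTriangle a b s = Set.Ico b (b + (s - (x - a))) := by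
        ext y
        simp only [halfOpenTriangle, Set.mem_preimage, Set.mem_ofPred_eq, Set.mem_Ico]
        exact ⟨fun h => ⟨h.2.1, by linarith [h.2.2]⟩, fun h => ⟨hx.1, h.1, by linarith [h.2]⟩⟩
      rw [this, Real.volume_Ico, add_sub_cancel_left]
    · rw [Set.indicator_of_notMem hx]
      have : Prod.mk x ⁻¹' halfOpenTriangle a b s = ∅ := by
        ext y
        simp only [halfOpenTriangle, Set.mem_preimage, Set.mem_ofPred_eq, Set.mem_empty_iff_false,
          iff_false]
        rintro ⟨h1, h2, h3⟩
        exact hx ⟨h1, by linarith⟩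
      rw [this, measure_empty]
  simp_rw [h1]
  rw [lintegral_indicator measurableSet_Icc, ← ofReal_integral_eq_lintegral_ofReal]
  · rw [integral_Icc_eq_integral_Ioc, ← intervalIntegral.integral_of_le (by linarith)]
    congr 1
    have h2 : ∀ x ∈ Set.uIcc a (a + s),
        HasDerivAt (fun x : ℝ => (s + a) * x - x ^ 2 / 2) (s - (x - a)) x := by
      intro x _
      have := ((hasDerivAt_id x).const_mul (s + a)).sub (((hasDerivAt_id x).pow 2).div_const 2)
      convert! this using 1
      simp; ring
    rw [intervalIntegral.integral_eq_sub_of_hasDerivAt h2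
      (Continuous.intervalIntegrable (by fun_prop) _ _)]
    ring
  · exact (Continuous.continuousOn (by fun_prop)).integrableOn_Icc
  · filter_upwards [ae_restrict_mem measurableSet_Icc] with x hx
    change 0 ≤ s - (x - a)
    linarith [hx.2]

/-- The half-open strip of height `1` above the hypotenuse of the triangle with legs `n`. -/
def diagonalStrip (n : ℝ) : Set Plane :=
  {x | 0 ≤ x.1 ∧ x.1 < n ∧ n ≤ x.1 + x.2 ∧ x.1 + x.2 < n + 1}

theorem measurableSet_diagonalStrip (n : ℝ) : MeasurableSet (diagonalStrip n) :=
  (measurableSet_le measurable_const measurable_fst).inter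
    ((measurableSet_lt measurable_fst measurable_const).inter
      ((measurableSet_le measurable_const (measurable_fst.add measurable_snd)).inter
        (measurableSet_lt (measurable_fst.add measurable_snd) measurable_const)))

theorem volume_diagonalStrip (n : ℝ) : volume (diagonalStrip n) = ENNReal.ofReal n := by
  rw [Measure.volume_eq_prod, Measure.prod_apply (measurableSet_diagonalStrip n)]
  have h1 : ∀ x : ℝ, volume (Prod.mk x ⁻¹' diagonalStrip n)
      = (Set.Ico 0 n).indicator (1 : ℝ → ℝ≥0∞) x := by
    intro x
    by_cases hx : x ∈ Set.Ico 0 n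
    · rw [Set.indicator_of_mem hx]
      have : Prod.mk x ⁻¹' diagonalStrip n = Set.Ico (n - x) (n - x + 1) := by
        ext y
        simp only [diagonalStrip, Set.mem_preimage, Set.mem_ofPred_eq, Set.mem_Ico]
        exact ⟨fun h => ⟨by linarith [h.2.2.1], by linarith [h.2.2.2]⟩,
          fun h => ⟨hx.1, hx.2, by linarith [h.1], by linarith [h.2]⟩⟩
      rw [this, Real.volume_Ico, add_sub_cancel_left]
      simp
    · rw [Set.indicator_of_notMem hx]
      have : Prod.mk x ⁻¹' diagonalStrip n = ∅ := by
        ext y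
        simp only [diagonalStrip, Set.mem_preimage, Set.mem_ofPred_eq, Set.mem_empty_iff_false,
          iff_false]
        rintro ⟨h1, h2, h3⟩
        exact hx ⟨h1, h2⟩
      rw [this, measure_empty]
  simp_rw [h1]
  rw [lintegral_indicator_one measurableSet_Ico, Real.volume_Ico, sub_zero]

/-! ### The first points of every class in the quadrant -/

/-- The key by which points are compared: first by the sum of the coordinates, the gauge of the
triangle, and then by the first coordinate. -/
def lexKey (v : Plane) : ℝ ×ₗ ℝ := toLex (v.1 + v.2, v.1)

/-- The positive cone of the total order given by `lexKey`. -/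
def LexPos (v : Plane) : Prop := 0 < v.1 + v.2 ∨ (v.1 + v.2 = 0 ∧ 0 < v.1)

theorem lexKey_lt {u v : Plane} : lexKey u < lexKey v ↔ LexPos (v - u) := by
  unfold lexKey LexPos
  rw [Prod.Lex.toLex_lt_toLex]
  simp only [Prod.fst_sub, Prod.snd_sub]
  constructor
  · rintro (h | ⟨h, h'⟩)
    · left; linarith
    · right; constructor <;> linarith
  · rintro (h | ⟨h, h'⟩)
    · left; linarith
    · right; constructor <;> linarith

theorem lexKey_injective : Function.Injective lexKey := by
  intro u v h
  have h' : (u.1 + u.2, u.1) = (v.1 + v.2, v.1) := toLex_inj.mp h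
  obtain ⟨h1, h2⟩ := Prod.mk.inj h'
  exact Prod.ext h2 (by linarith)

theorem LexPos.sum_nonneg {v : Plane} (h : LexPos v) : 0 ≤ v.1 + v.2 := by
  rcases h with h | h
  · exact h.le
  · exact h.1.ge

/-- The positive lattice vectors dominated coordinatewise by `x`. Subtracting them from `x` gives
the points of `x + L` in the quadrant that precede `x`. -/
def dominated (L : Submodule ℤ Plane) (x : Plane) : Set Plane :=
  {v | v ∈ L ∧ LexPos v ∧ v.1 ≤ x.1 ∧ v.2 ≤ x.2}

theorem HasCovolume.finite_dominated {L : Submodule ℤ Plane} {D : ℝ} (h : HasCovolume L D)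
    (x : Plane) : (dominated L x).Finite := by
  refine h.finite_of_bounded (fun v hv => hv.1) ?_
  refine (Metric.isBounded_Icc ((-x.2, -x.1) : Plane) x).subset ?_
  rintro v ⟨-, hp, h1, h2⟩
  have := hp.sum_nonneg
  exact ⟨⟨by linarith, by linarith⟩, ⟨h1, h2⟩⟩

/-- The region of the points of the quadrant that have fewer than `j` predecessors in their
class modulo `L`. -/
def lowRegion (L : Submodule ℤ Plane) (j : ℕ) : Set Plane :=
  {x | 0 ≤ x.1 ∧ 0 ≤ x.2 ∧ (dominated L x).encard < j}

/-- Every class modulo `L` has at most `j` points in the low region. -/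
theorem encard_le_of_subset_lowRegion (L : Submodule ℤ Plane) {j : ℕ} {S : Set Plane}
    (hS : S ⊆ lowRegion L j) (p : Plane) :
    ({v | v ∈ L ∧ p - v ∈ S} : Set Plane).encard ≤ j := by
  by_contra! hlt
  have hle : ((j + 1 : ℕ) : ℕ∞) ≤ ({v | v ∈ L ∧ p - v ∈ S} : Set Plane).encard := by
    exact_mod_cast Order.add_one_le_of_lt hlt
  obtain ⟨W, hW, hcard⟩ := Set.exists_subset_encard_eq hle
  have hfin : W.Finite := Set.finite_of_encard_eq_coe hcard
  have hne : W.Nonempty := by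
    rw [← Set.encard_ne_zero, hcard]; exact_mod_cast Nat.succ_ne_zero j
  obtain ⟨v₀, hv₀, hmin⟩ := Set.exists_min_image W lexKey hfin hne
  have hx := hS (hW hv₀).2
  have himg : (fun v => v - v₀) '' (W \ {v₀}) ⊆ dominated L (p - v₀) := by
    rintro _ ⟨v, ⟨hv, hvne⟩, rfl⟩
    have hlt : lexKey v₀ < lexKey v :=
      lt_of_le_of_ne (hmin v hv) (fun h => hvne (lexKey_injective h.symm))
    have hq := hS (hW hv).2
    refine ⟨L.sub_mem (hW hv).1 (hW hv₀).1, lexKey_lt.mp hlt, ?_, ?_⟩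
    · have := hq.1
      simp only [Prod.fst_sub] at this ⊢
      linarith
    · have := hq.2.1
      simp only [Prod.snd_sub] at this ⊢
      linarith
  have h1 : (W \ {v₀}).encard = j := by
    rw [Set.encard_sdiff_singleton_of_mem hv₀, hcard]
    exact_mod_cast rfl
  have h2 := (Set.encard_le_encard himg).trans_lt hx.2.2
  rw [(sub_left_injective (b := v₀)).encard_image, h1] at h2
  exact lt_irrefl _ h2

/-- If the translates of the open triangle form a `j`-fold packing, then the half-open triangle
lies in the low region. -/
theorem mem_lowRegion_of_packing {L : Submodule ℤ Plane} {j : ℕ} {n : ℝ}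
    (hpack : ∀ x : Plane,
      ({v | v ∈ L ∧ (0 < x.1 - v.1 ∧ 0 < x.2 - v.2 ∧ x.1 - v.1 + (x.2 - v.2) < n)} :
        Set Plane).encard ≤ j) {x : Plane} (h1 : 0 ≤ x.1) (h2 : 0 ≤ x.2) (h3 : x.1 + x.2 < n) :
    x ∈ lowRegion L j := by
  refine ⟨h1, h2, ?_⟩
  -- a small shift into the quadrant moves `x` and its predecessors off the legs of the triangle
  obtain ⟨ε, hε, hεn⟩ : ∃ ε : ℝ, 0 < ε ∧ x.1 + x.2 + 2 * ε < n :=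
    ⟨(n - (x.1 + x.2)) / 3, by linarith, by linarith⟩
  have hsub : insert 0 (dominated L x) ⊆ ({v | v ∈ L ∧ (0 < (x + (ε, ε)).1 - v.1 ∧
      0 < (x + (ε, ε)).2 - v.2 ∧ (x + (ε, ε)).1 - v.1 + ((x + (ε, ε)).2 - v.2) < n)} :
        Set Plane) := by
    rintro v (rfl | ⟨hv, hp, hv1, hv2⟩)
    · refine ⟨L.zero_mem, ?_, ?_, ?_⟩ <;>
        simp only [Prod.fst_add, Prod.snd_add, Prod.fst_zero, Prod.snd_zero] <;> linarith
    · have := hp.sum_nonneg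
      refine ⟨hv, ?_, ?_, ?_⟩ <;> simp only [Prod.fst_add, Prod.snd_add] <;> linarith
  have h0 : (0 : Plane) ∉ dominated L x := by
    rintro ⟨-, hp, -⟩
    simp [LexPos] at hp
  have h := (Set.encard_le_encard hsub).trans (hpack _)
  rw [Set.encard_insert_of_notMem h0] at h
  have hne : (dominated L x).encard ≠ ⊤ := by
    intro htop
    rw [htop] at h
    simp at h
  exact (ENat.add_one_le_iff hne).mp h

/-- The elements of `P` with fewer than `j` predecessors in `P`. -/
def firstElements {α : Type*} [LinearOrder α] (P : Set α) (j : ℕ) : Set α :=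
  {p | p ∈ P ∧ ({q | q ∈ P ∧ q < p} : Set α).encard < j}

theorem encard_firstElements_le {α : Type*} [LinearOrder α] (P : Set α) (j : ℕ) :
    (firstElements P j).encard ≤ j := by
  by_contra! hlt
  have hle : ((j + 1 : ℕ) : ℕ∞) ≤ (firstElements P j).encard := by
    exact_mod_cast Order.add_one_le_of_lt hlt
  obtain ⟨W, hW, hcard⟩ := Set.exists_subset_encard_eq hle
  have hfin : W.Finite := Set.finite_of_encard_eq_coe hcard
  have hne : W.Nonempty := by
    rw [← Set.encard_ne_zero, hcard]; exact_mod_cast Nat.succ_ne_zero j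
  obtain ⟨m, hm, hmax⟩ := Set.exists_max_image W id hfin hne
  have hsub : W \ {m} ⊆ {q | q ∈ P ∧ q < m} := fun q hq =>
    ⟨(hW hq.1).1, lt_of_le_of_ne (hmax q hq.1) hq.2⟩
  have h1 : (W \ {m}).encard = j := by
    rw [Set.encard_sdiff_singleton_of_mem hm, hcard]
    exact_mod_cast rfl
  have h2 := (Set.encard_le_encard hsub).trans_lt (hW hm).2
  rw [h1] at h2
  exact lt_irrefl _ h2

/-- The positive lattice vectors in the left half plane. -/
def leftVectors (L : Submodule ℤ Plane) : Set Plane := {v | v ∈ L ∧ LexPos v ∧ v.1 ≤ 0}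

/-- The lattice vectors in the open quadrant. -/
def quadrantVectors (L : Submodule ℤ Plane) : Set Plane := {v | v ∈ L ∧ 0 < v.1 ∧ 0 < v.2}

/-- The possible heights of the horizontal steps of the boundary of the low region: the first `j`
ordinates of vectors in the left half plane, and the ordinates of the first `j` vectors of the
open quadrant. The ordinate is recovered from the key as the difference of its entries. -/
def stepHeights (L : Submodule ℤ Plane) (j : ℕ) : Set ℝ :=
  firstElements (Prod.snd '' leftVectors L) j ∪
    (fun k : ℝ ×ₗ ℝ => (ofLex k).1 - (ofLex k).2) ''
      firstElements (lexKey '' quadrantVectors L) j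

theorem encard_stepHeights_le (L : Submodule ℤ Plane) (j : ℕ) :
    (stepHeights L j).encard ≤ (2 * j : ℕ) := by
  refine (Set.encard_union_le _ _).trans ?_
  have h1 := encard_firstElements_le (Prod.snd '' leftVectors L) j
  have h2 := (Set.encard_image_le (fun k : ℝ ×ₗ ℝ => (ofLex k).1 - (ofLex k).2)
    (firstElements (lexKey '' quadrantVectors L) j)).trans (encard_firstElements_le _ j)
  calc _ ≤ (j : ℕ∞) + j := add_le_add h1 h2
    _ = _ := by push_cast; ring

/-- A vertical segment that starts in the low region leaves it at a step height. -/
theorem exists_stepHeight {L : Submodule ℤ Plane} {D : ℝ} (hL : HasCovolume L D) {j : ℕ}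
    (hj : 1 ≤ j) {x : Plane} {t : ℝ} (ht : 0 < t) (hx : x ∉ lowRegion L j) (hx1 : 0 ≤ x.1)
    (hx2 : 0 ≤ x.2)
    (hlow : ∀ y, 0 ≤ y → y < t → (x.1, y) ∈ lowRegion L j) :
    ∃ η ∈ stepHeights L j, t ≤ η ∧ η ≤ x.2 := by
  have hxj : (j : ℕ∞) ≤ (dominated L x).encard := by
    by_contra! h
    exact hx ⟨hx1, hx2, h⟩
  have hfin := hL.finite_dominated x
  set W := dominated L x with hW
  -- `v₀` is a dominated vector of least ordinate such that `j` dominated vectors are not above it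
  set G : Set Plane := {v | v ∈ W ∧ (j : ℕ∞) ≤ ({w | w ∈ W ∧ w.2 ≤ v.2} : Set Plane).encard}
  have hWne : W.Nonempty := by
    rw [← Set.encard_ne_zero]
    intro h0
    rw [h0] at hxj
    have : j ≤ 0 := by exact_mod_cast hxj
    omega
  have hGne : G.Nonempty := by
    obtain ⟨m, hm, hmax⟩ := Set.exists_max_image W Prod.snd hfin hWne
    refine ⟨m, hm, ?_⟩
    have : ({w | w ∈ W ∧ w.2 ≤ m.2} : Set Plane) = W := by
      ext w; exact ⟨fun h => h.1, fun h => ⟨h, hmax w h⟩⟩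
    rwa [this]
  obtain ⟨v₀, hv₀, hmin⟩ := Set.exists_min_image G Prod.snd (hfin.subset fun v hv => hv.1) hGne
  have hstrict : ({w | w ∈ W ∧ w.2 < v₀.2} : Set Plane).encard < j := by
    by_contra! hge
    have hUfin : ({w | w ∈ W ∧ w.2 < v₀.2} : Set Plane).Finite := hfin.subset fun w hw => hw.1
    have hUne : ({w | w ∈ W ∧ w.2 < v₀.2} : Set Plane).Nonempty := by
      rw [← Set.encard_ne_zero]
      intro h0
      rw [h0] at hge
      have : j ≤ 0 := by exact_mod_cast hge
      omega
    obtain ⟨w, hw, hmax⟩ := Set.exists_max_image _ Prod.snd hUfin hUne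
    have hwG : w ∈ G := ⟨hw.1, hge.trans (Set.encard_le_encard fun u hu => ⟨hu.1, hmax u hu⟩)⟩
    exact absurd (hmin w hwG) (not_le.mpr hw.2)
  have hv₀x := hv₀.1.2.2
  have hdom : ∀ y, v₀.2 ≤ y → (j : ℕ∞) ≤ (dominated L (x.1, y)).encard := fun y hy =>
    hv₀.2.trans (Set.encard_le_encard fun w hw =>
      ⟨hw.1.1, hw.1.2.1, hw.1.2.2.1, hw.2.trans hy⟩)
  have htv : t ≤ v₀.2 := by
    by_contra! h
    have h0 : max 0 v₀.2 < t := max_lt ht h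
    exact absurd (hlow _ (le_max_left _ _) h0).2.2 (not_lt.mpr (hdom _ (le_max_right _ _)))
  refine ⟨v₀.2, ?_, htv, hv₀x.2⟩
  rcases le_or_gt v₀.1 0 with h1 | h1
  · left
    refine ⟨⟨v₀, ⟨hv₀.1.1, hv₀.1.2.1, h1⟩, rfl⟩, lt_of_le_of_lt ?_ hstrict⟩
    have hsub : ({q | q ∈ Prod.snd '' leftVectors L ∧ q < v₀.2} : Set ℝ)
        ⊆ Prod.snd '' {w | w ∈ W ∧ w.2 < v₀.2} := by
      rintro _ ⟨⟨b, hb, rfl⟩, hlt⟩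
      exact ⟨b, ⟨⟨hb.1, hb.2.1, hb.2.2.trans hx1, hlt.le.trans hv₀x.2⟩, hlt⟩, rfl⟩
    exact (Set.encard_le_encard hsub).trans (Set.encard_image_le _ _)
  · right
    refine ⟨lexKey v₀, ⟨⟨v₀, ⟨hv₀.1.1, h1, ht.trans_le htv⟩, rfl⟩, lt_of_le_of_lt ?_ hstrict⟩, ?_⟩
    · -- a predecessor `c` of `v₀` in the quadrant yields the dominated vector `v₀ - c`
      have hsub : ({q | q ∈ lexKey '' quadrantVectors L ∧ q < lexKey v₀} : Set (ℝ ×ₗ ℝ))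
          ⊆ (fun w => lexKey (v₀ - w)) '' {w | w ∈ W ∧ w.2 < v₀.2} := by
        rintro _ ⟨⟨c, ⟨hcL, hc1, hc2⟩, rfl⟩, hlt⟩
        refine ⟨v₀ - c, ⟨⟨L.sub_mem hv₀.1.1 hcL, lexKey_lt.mp hlt, ?_, ?_⟩, ?_⟩, ?_⟩
        · simp only [Prod.fst_sub]; linarith [hv₀x.1]
        · simp only [Prod.snd_sub]; linarith [hv₀x.2]
        · simp only [Prod.snd_sub]; linarith
        · simp
      exact (Set.encard_le_encard hsub).trans (Set.encard_image_le _ _)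
    · simp [lexKey]

/-! ### Areas of staircases that contain a triangle -/

/-- The points of the unit strip above the hypotenuse whose vertical segment down to the hypotenuse
passes the height `η`. -/
def stepTriangle (n η : ℝ) : Set Plane := halfOpenTriangle (n - η) η 1

/-- The half-open triangle with legs `n` together with the part of the unit strip above its
hypotenuse that is reached from below without passing a height in `Y`. -/
def unblockedRegion (n : ℝ) (Y : Finset ℝ) : Set Plane :=
  halfOpenTriangle 0 0 n ∪ (diagonalStrip n \ ⋃ η ∈ Y, stepTriangle n η)

theorem measurableSet_iUnion_stepTriangle (n : ℝ) (Y : Finset ℝ) :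
    MeasurableSet (⋃ η ∈ Y, stepTriangle n η) :=
  Y.measurableSet_biUnion fun _ _ => measurableSet_halfOpenTriangle _ _ _

theorem measurableSet_unblockedRegion (n : ℝ) (Y : Finset ℝ) :
    MeasurableSet (unblockedRegion n Y) :=
  (measurableSet_halfOpenTriangle _ _ _).union
    ((measurableSet_diagonalStrip n).diff (measurableSet_iUnion_stepTriangle n Y))

theorem volume_stepTriangle (n η : ℝ) : volume (stepTriangle n η) = ENNReal.ofReal (1 / 2) := by
  rw [stepTriangle, volume_halfOpenTriangle _ _ zero_le_one]
  norm_num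

theorem volume_unblockedRegion_add {n : ℝ} (hn : 0 ≤ n) (Y : Finset ℝ) :
    volume (unblockedRegion n Y) + volume (diagonalStrip n ∩ ⋃ η ∈ Y, stepTriangle n η)
      = ENNReal.ofReal (n ^ 2 / 2 + n) := by
  have hd : Disjoint (halfOpenTriangle 0 0 n) (diagonalStrip n \ ⋃ η ∈ Y, stepTriangle n η) := by
    rw [Set.disjoint_left]
    rintro x ⟨-, -, h⟩ ⟨⟨-, -, h', -⟩, -⟩
    linarith
  rw [unblockedRegion, measure_union hd
    ((measurableSet_diagonalStrip n).diff (measurableSet_iUnion_stepTriangle n Y)), add_assoc,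
    measure_sdiff_add_inter _ (measurableSet_iUnion_stepTriangle n Y), volume_diagonalStrip,
    volume_halfOpenTriangle _ _ hn, ENNReal.ofReal_add (by positivity) hn]

theorem volume_iUnion_stepTriangle_le (n : ℝ) (Y : Finset ℝ) :
    volume (⋃ η ∈ Y, stepTriangle n η) ≤ ENNReal.ofReal (Y.card / 2) := by
  refine (measure_biUnion_finset_le _ _).trans ?_
  simp_rw [volume_stepTriangle]
  rw [Finset.sum_const, nsmul_eq_mul, ← ENNReal.ofReal_natCast,
    ← ENNReal.ofReal_mul (by positivity)]
  apply ENNReal.ofReal_le_ofReal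
  linarith

theorem volume_unblockedRegion_ge {n : ℕ} {Y : Finset ℝ} (hY : Y.card ≤ n) :
    ENNReal.ofReal ((n : ℝ) ^ 2 / 2 + n / 2) ≤ volume (unblockedRegion n Y) := by
  have h1 := volume_unblockedRegion_add (n := n) (by positivity) Y
  have h2 : volume (diagonalStrip n ∩ ⋃ η ∈ Y, stepTriangle n η) ≤ ENNReal.ofReal ((n : ℝ) / 2) :=
    ((measure_mono Set.inter_subset_right).trans (volume_iUnion_stepTriangle_le n Y)).trans
      (ENNReal.ofReal_le_ofReal (by
        have : (Y.card : ℝ) ≤ n := by exact_mod_cast hY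
        linarith))
  have h3 : ENNReal.ofReal ((n : ℝ) ^ 2 / 2 + n / 2) + ENNReal.ofReal ((n : ℝ) / 2)
      ≤ volume (unblockedRegion n Y) + ENNReal.ofReal ((n : ℝ) / 2) := by
    rw [← ENNReal.ofReal_add (by positivity) (by positivity)]
    calc _ = ENNReal.ofReal ((n : ℝ) ^ 2 / 2 + n) := by congr 1; ring
      _ = _ := h1.symm
      _ ≤ _ := by gcongr
  exact (ENNReal.add_le_add_iff_right ENNReal.ofReal_ne_top).mp h3

/-- If the unblocked region has the least possible area, then no step triangle contains a set of
positive area that lies outside the strip or is covered by the other step triangles. -/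
theorem volume_eq_zero_of_minimal {n : ℕ} {Y : Finset ℝ} (hY : Y.card ≤ n)
    (hmin : volume (unblockedRegion n Y) ≤ ENNReal.ofReal ((n : ℝ) ^ 2 / 2 + n / 2))
    {η : ℝ} (hη : η ∈ Y) {V : Set Plane} (hV : MeasurableSet V) (hVη : V ⊆ stepTriangle n η)
    (hVc : V ∩ diagonalStrip n ⊆ ⋃ η' ∈ Y.erase η, stepTriangle n η') : volume V = 0 := by
  have h1 := volume_unblockedRegion_add (n := n) (by positivity) Y
  set U := ⋃ η ∈ Y, stepTriangle n η
  have h2 : ENNReal.ofReal ((n : ℝ) / 2) ≤ volume (diagonalStrip n ∩ U) := by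
    have h3 : ENNReal.ofReal ((n : ℝ) ^ 2 / 2 + n / 2) + ENNReal.ofReal ((n : ℝ) / 2)
        ≤ ENNReal.ofReal ((n : ℝ) ^ 2 / 2 + n / 2) + volume (diagonalStrip n ∩ U) := by
      rw [← ENNReal.ofReal_add (by positivity) (by positivity)]
      calc _ = ENNReal.ofReal ((n : ℝ) ^ 2 / 2 + n) := by congr 1; ring
        _ = _ := h1.symm
        _ ≤ _ := by gcongr
    exact (ENNReal.add_le_add_iff_left ENNReal.ofReal_ne_top).mp h3
  have h4 : diagonalStrip n ∩ U
      ⊆ (stepTriangle n η \ V) ∪ ⋃ η' ∈ Y.erase η, stepTriangle n η' := by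
    rintro x ⟨hxB, hxU⟩
    obtain ⟨η', hη', hx⟩ := Set.mem_iUnion₂.mp hxU
    by_cases hxV : x ∈ V
    · exact Or.inr (hVc ⟨hxV, hxB⟩)
    · by_cases he : η' = η
      · exact Or.inl ⟨he ▸ hx, hxV⟩
      · exact Or.inr (Set.mem_iUnion₂.mpr ⟨η', Finset.mem_erase.mpr ⟨he, hη'⟩, hx⟩)
  have hcard : ((Y.erase η).card : ℝ) + 1 ≤ n := by
    have := Finset.card_erase_add_one hη
    exact_mod_cast this.trans_le hY
  have h5 : ENNReal.ofReal ((n : ℝ) / 2) + volume V ≤ ENNReal.ofReal ((n : ℝ) / 2) := by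
    calc _ ≤ volume (diagonalStrip n ∩ U) + volume V := by gcongr
      _ ≤ volume (stepTriangle n η \ V) + ENNReal.ofReal ((Y.erase η).card / 2) + volume V := by
        gcongr
        exact (measure_mono h4).trans ((measure_union_le _ _).trans
          (by gcongr; exact volume_iUnion_stepTriangle_le _ _))
      _ = (volume (stepTriangle n η \ V) + volume V) + ENNReal.ofReal ((Y.erase η).card / 2) := by
        ring
      _ = ENNReal.ofReal (1 / 2) + ENNReal.ofReal ((Y.erase η).card / 2) := by
        have := measure_sdiff_add_inter (μ := volume) (stepTriangle n η) hV
        rw [Set.inter_eq_right.mpr hVη, volume_stepTriangle] at this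
        rw [this]
      _ ≤ _ := by
        rw [← ENNReal.ofReal_add (by positivity) (by positivity)]
        apply ENNReal.ofReal_le_ofReal
        linarith
  have h6 : ENNReal.ofReal ((n : ℝ) / 2) + volume V ≤ ENNReal.ofReal ((n : ℝ) / 2) + 0 := by
    simpa using h5
  exact le_antisymm ((ENNReal.add_le_add_iff_left ENNReal.ofReal_ne_top).mp h6) bot_le

/-- A set of `n` reals in `[1, n]` with mutual distances at least `1` consists of integers. -/
theorem exists_int_eq_of_separated {n : ℕ} {Y : Finset ℝ} (hcard : Y.card = n)
    (h1 : ∀ η ∈ Y, 1 ≤ η) (hn : ∀ η ∈ Y, η ≤ n)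
    (hsep : ∀ η ∈ Y, ∀ η' ∈ Y, η < η' → η + 1 ≤ η') : ∀ η ∈ Y, ∃ k : ℤ, η = k := by
  classical
  by_contra! hcon
  obtain ⟨η₁, hη₁, hk₁⟩ := hcon
  obtain ⟨η, hη, hmax⟩ := Finset.exists_max_image (Y.filter fun η : ℝ => ∀ k : ℤ, η ≠ k) id
    ⟨η₁, Finset.mem_filter.mpr ⟨hη₁, hk₁⟩⟩
  rw [Finset.mem_filter] at hη
  have hmaps : Set.MapsTo (fun η : ℝ => ⌊η⌋) (Y : Set ℝ) (Finset.Icc (1 : ℤ) n : Finset ℤ) := by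
    intro η hη
    rw [Finset.mem_coe, Finset.mem_Icc]
    refine ⟨Int.le_floor.mpr (by exact_mod_cast h1 η hη), ?_⟩
    have : (⌊η⌋ : ℝ) ≤ n := (Int.floor_le η).trans (hn η hη)
    exact_mod_cast this
  have hinj : Set.InjOn (fun η : ℝ => ⌊η⌋) (Y : Set ℝ) := by
    have key : ∀ a ∈ Y, ∀ b ∈ Y, ⌊a⌋ = ⌊b⌋ → ¬ a < b := by
      intro a ha b hb hab hlt
      have h := hsep a ha b hb hlt
      have h2 := Int.floor_le a
      have h3 := Int.lt_floor_add_one b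
      rw [← hab] at h3
      linarith
    intro a ha b hb hab
    exact le_antisymm (not_lt.mp (key b hb a ha hab.symm)) (not_lt.mp (key a ha b hb hab))
  have hsurj := Finset.surjOn_of_injOn_of_card_le _ hmaps hinj (by simp [hcard])
  have hfl : (⌊η⌋ : ℝ) < η := lt_of_le_of_ne (Int.floor_le η) (fun h => hη.2 _ h.symm)
  have hfl1 : 1 ≤ ⌊η⌋ := Int.le_floor.mpr (by exact_mod_cast h1 η hη.1)
  have hlt : ⌊η⌋ < n := by
    have : (⌊η⌋ : ℝ) < n := hfl.trans_le (hn η hη.1)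
    exact_mod_cast this
  obtain ⟨η', hη', hfl'⟩ := hsurj (show ⌊η⌋ + 1 ∈ ((Finset.Icc (1 : ℤ) n : Finset ℤ) : Set ℤ) by
    rw [Finset.mem_coe, Finset.mem_Icc]; omega)
  simp only at hfl'
  have hlt' : η < η' := by
    have h2 := Int.lt_floor_add_one η
    have h3 := Int.floor_le η'
    rw [hfl'] at h3
    push_cast at h3
    linarith
  have hint : ∃ k : ℤ, η' = k := by
    by_contra! hne
    exact absurd (hmax η' (Finset.mem_filter.mpr ⟨hη', hne⟩)) (not_le.mpr hlt')
  obtain ⟨k, hk⟩ := hint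
  have hk' : k = ⌊η⌋ + 1 := by rw [← hfl', hk, Int.floor_intCast]
  have h4 := hsep η hη.1 η' hη' hlt'
  rw [hk, hk'] at h4
  push_cast at h4
  linarith

theorem exists_int_eq_of_minimal {n : ℕ} {Y : Finset ℝ} (hY : Y.card ≤ n)
    (hmin : volume (unblockedRegion n Y) ≤ ENNReal.ofReal ((n : ℝ) ^ 2 / 2 + n / 2)) :
    ∀ η ∈ Y, ∃ k : ℤ, η = k := by
  have hpos : ∀ {η a b s : ℝ}, η ∈ Y → 0 < s → halfOpenTriangle a b s ⊆ stepTriangle n η →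
      halfOpenTriangle a b s ∩ diagonalStrip n ⊆ ⋃ η' ∈ Y.erase η, stepTriangle n η' → False := by
    intro η a b s hη hs h1 h2
    have h := volume_eq_zero_of_minimal hY hmin hη (measurableSet_halfOpenTriangle a b s) h1 h2
    rw [volume_halfOpenTriangle _ _ hs.le, ENNReal.ofReal_eq_zero] at h
    nlinarith [pow_pos hs 2]
  refine exists_int_eq_of_separated (n := n) ?_ ?_ ?_ ?_
  · refine le_antisymm hY ?_
    have h1 := volume_unblockedRegion_add (n := n) (by positivity) Y
    have h2 : ENNReal.ofReal ((n : ℝ) ^ 2 / 2 + n)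
        ≤ ENNReal.ofReal ((n : ℝ) ^ 2 / 2 + n / 2 + Y.card / 2) := by
      rw [← h1, ENNReal.ofReal_add (by positivity) (by positivity)]
      gcongr
      exact (measure_mono Set.inter_subset_right).trans (volume_iUnion_stepTriangle_le _ _)
    rw [ENNReal.ofReal_le_ofReal_iff (by positivity)] at h2
    have : (n : ℝ) ≤ Y.card := by linarith
    exact_mod_cast this
  · intro η hη
    by_contra! hlt
    -- the part of the step triangle to the right of the strip
    refine hpos (a := max (n : ℝ) (n - η)) (b := η)
      (s := n + 1 - η - max (n : ℝ) (n - η)) hη ?_ ?_ ?_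
    · have : max (n : ℝ) (n - η) < n + 1 - η := max_lt (by linarith) (by linarith)
      linarith
    · rintro x ⟨h1, h2, h3⟩
      exact ⟨(le_max_right _ _).trans h1, h2, by linarith⟩
    · rintro x ⟨⟨h1, -, -⟩, ⟨-, h2, -⟩⟩
      exact absurd ((le_max_left _ _).trans h1) (not_le.mpr h2)
  · intro η hη
    by_contra! hlt
    -- the part of the step triangle to the left of the strip
    refine hpos (a := n - η) (b := η) (s := min 1 (η - n)) hη ?_ ?_ ?_
    · exact lt_min one_pos (by linarith)
    · rintro x ⟨h1, h2, h3⟩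
      exact ⟨h1, h2, by linarith [min_le_left 1 (η - n)]⟩
    · rintro x ⟨⟨h1, h2, h3⟩, ⟨h4, -⟩⟩
      linarith [min_le_right 1 (η - n)]
  · intro η hη η' hη' hlt
    by_contra! hlt'
    -- the intersection of two step triangles
    refine hpos (a := n - η) (b := η') (s := 1 - (η' - η)) hη (by linarith) ?_ ?_
    · rintro x ⟨h1, h2, h3⟩
      exact ⟨h1, by linarith, by linarith⟩
    · rintro x ⟨⟨h1, h2, h3⟩, -⟩
      exact Set.mem_iUnion₂.mpr ⟨η', Finset.mem_erase.mpr ⟨hlt.ne', hη'⟩,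
        ⟨by linarith, h2, by linarith⟩⟩

/-- The staircase made of the unit cells `[a, a + 1) × [b, b + 1)`, `a, b ≥ 0`, `a + b < n`. -/
def staircase (n : ℕ) : Set Plane := {x | 0 ≤ x.1 ∧ 0 ≤ x.2 ∧ ⌊x.1⌋ + ⌊x.2⌋ < (n : ℤ)}

theorem measurableSet_staircase (n : ℕ) : MeasurableSet (staircase n) :=
  (measurableSet_le measurable_const measurable_fst).inter
    ((measurableSet_le measurable_const measurable_snd).inter
      (measurableSet_lt (measurable_fst.floor.add measurable_snd.floor) measurable_const))

theorem staircase_subset_unblockedRegion {n : ℕ} {Y : Finset ℝ} (hY : ∀ η ∈ Y, ∃ k : ℤ, η = k) :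
    staircase n ⊆ unblockedRegion n Y := by
  rintro x ⟨h1, h2, h3⟩
  by_cases hlt : x.1 + x.2 < n
  · exact Or.inl ⟨h1, h2, by linarith⟩
  · have hf1 : 0 ≤ ⌊x.1⌋ := Int.floor_nonneg.mpr h1
    have hf2 : 0 ≤ ⌊x.2⌋ := Int.floor_nonneg.mpr h2
    have hx1 := Int.lt_floor_add_one x.1
    have hx2 := Int.lt_floor_add_one x.2
    have hsum : (⌊x.1⌋ : ℝ) + ⌊x.2⌋ + 1 ≤ n := by exact_mod_cast h3
    have hf2' : (0 : ℝ) ≤ ⌊x.2⌋ := by exact_mod_cast hf2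
    refine Or.inr ⟨⟨h1, by linarith, by linarith, by linarith⟩, ?_⟩
    intro hU
    obtain ⟨η, hη, ha, hb, -⟩ := Set.mem_iUnion₂.mp hU
    obtain ⟨k, rfl⟩ := hY η hη
    have hk2 : k ≤ ⌊x.2⌋ := Int.le_floor.mpr hb
    have hk1 : (n : ℤ) - k ≤ ⌊x.1⌋ := Int.le_floor.mpr (by push_cast; exact ha)
    omega

theorem volume_staircase_ge (n : ℕ) :
    ENNReal.ofReal ((n : ℝ) ^ 2 / 2 + n / 2) ≤ volume (staircase n) := by
  refine (volume_unblockedRegion_ge (n := n) (Y := (Finset.Icc 1 n).image (fun k : ℕ => (k : ℝ)))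
    (Finset.card_image_le.trans (by simp))).trans (measure_mono ?_)
  rintro x (⟨h1, h2, h3⟩ | ⟨⟨h1, h2, h3, h4⟩, hU⟩)
  · refine ⟨h1, h2, ?_⟩
    have : (⌊x.1⌋ : ℝ) + ⌊x.2⌋ < n := by linarith [Int.floor_le x.1, Int.floor_le x.2]
    exact_mod_cast this
  · have hx2 : 0 ≤ x.2 := by linarith
    refine ⟨h1, hx2, ?_⟩
    by_contra! hge
    have hf1 : 0 ≤ ⌊x.1⌋ := Int.floor_nonneg.mpr h1
    have hlt : ⌊x.1⌋ < n := by
      have : (⌊x.1⌋ : ℝ) < n := (Int.floor_le _).trans_lt h2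
      exact_mod_cast this
    obtain ⟨k, hk⟩ : ∃ k : ℕ, (k : ℤ) = n - ⌊x.1⌋ := ⟨(n - ⌊x.1⌋).toNat, by omega⟩
    have hkR : (k : ℝ) = n - ⌊x.1⌋ := by exact_mod_cast hk
    refine hU (Set.mem_iUnion₂.mpr ⟨(k : ℝ), ?_, ?_, ?_, ?_⟩)
    · exact Finset.mem_image.mpr ⟨k, Finset.mem_Icc.mpr ⟨by omega, by omega⟩, rfl⟩
    · linarith [Int.floor_le x.1]
    · have : (k : ℤ) ≤ ⌊x.2⌋ := by omega
      exact_mod_cast Int.le_floor.mp this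
    · linarith

/-! ### The lower bound for the covolume and the exact tiling -/

/-- A small step in the direction of the quadrant does not lead into the staircase from outside,
uniformly for all translates by the lattice. -/
theorem HasCovolume.eventually_staircase {L : Submodule ℤ Plane} {D : ℝ} (hL : HasCovolume L D)
    (n : ℕ) (p : Plane) :
    ∀ᶠ ε in nhdsWithin (0 : ℝ) (Set.Ioi 0), ∀ q : Plane, p.1 ≤ q.1 → q.1 < p.1 + ε →
      p.2 ≤ q.2 → q.2 < p.2 + ε → ∀ v ∈ L, q - v ∈ staircase n → p - v ∈ staircase n := by
  have hfin : ({v | v ∈ L ∧ v ∈ Set.Icc (p - ((n : ℝ), (n : ℝ))) (p + (1, 1))} : Set Plane).Finite :=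
    hL.finite_of_bounded (fun v hv => hv.1)
      ((Metric.isBounded_Icc (p - ((n : ℝ), (n : ℝ))) (p + (1, 1))).subset fun v hv => hv.2)
  have hev : ∀ v ∈ ({v | v ∈ L ∧ v ∈ Set.Icc (p - ((n : ℝ), (n : ℝ))) (p + (1, 1))} : Set Plane),
      ∀ᶠ ε in nhdsWithin (0 : ℝ) (Set.Ioi 0), ∀ q : Plane, p.1 ≤ q.1 → q.1 < p.1 + ε →
      p.2 ≤ q.2 → q.2 < p.2 + ε → q - v ∈ staircase n → p - v ∈ staircase n := by
    intro v _
    have hmono : ∀ q : Plane, p.1 ≤ q.1 → p.2 ≤ q.2 → v.1 ≤ p.1 → v.2 ≤ p.2 →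
        q - v ∈ staircase n → p - v ∈ staircase n := by
      rintro q hq1 hq2 h1 h2 ⟨-, -, h5⟩
      simp only [Prod.fst_sub, Prod.snd_sub] at h5
      refine ⟨sub_nonneg.mpr h1, sub_nonneg.mpr h2, lt_of_le_of_lt ?_ h5⟩
      exact add_le_add (Int.floor_le_floor (by simpa using hq1))
        (Int.floor_le_floor (by simpa using hq2))
    have hsmall : ∀ c : ℝ, 0 < c → ∀ᶠ ε in nhdsWithin (0 : ℝ) (Set.Ioi 0), ε < c := fun c hc =>
      nhdsWithin_le_nhds (eventually_lt_nhds hc)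
    rcases le_or_gt v.1 p.1 with h1 | h1
    · rcases le_or_gt v.2 p.2 with h2 | h2
      · exact Eventually.of_forall fun ε q hq1 _ hq2 _ => hmono q hq1 hq2 h1 h2
      · filter_upwards [hsmall (v.2 - p.2) (by linarith)] with ε hε q _ _ _ hq hmem
        have := hmem.2.1
        simp only [Prod.snd_sub] at this
        linarith
    · filter_upwards [hsmall (v.1 - p.1) (by linarith)] with ε hε q _ hq _ _ hmem
      have := hmem.1
      simp only [Prod.fst_sub] at this
      linarith
  filter_upwards [(Filter.eventually_all_finite hfin).mpr hev,
    nhdsWithin_le_nhds (eventually_lt_nhds one_pos)] with ε hε hε1 q hq1 hq1' hq2 hq2' v hv hmem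
  refine hε v ⟨hv, ?_⟩ q hq1 hq1' hq2 hq2' hmem
  obtain ⟨h1, h2, h3⟩ := hmem
  have hf1 : 0 ≤ ⌊(q - v).1⌋ := Int.floor_nonneg.mpr h1
  have hf2 : 0 ≤ ⌊(q - v).2⌋ := Int.floor_nonneg.mpr h2
  have h4 : (⌊(q - v).1⌋ : ℝ) + 1 ≤ n := by exact_mod_cast (by omega : ⌊(q - v).1⌋ + 1 ≤ (n : ℤ))
  have h5 : (⌊(q - v).2⌋ : ℝ) + 1 ≤ n := by exact_mod_cast (by omega : ⌊(q - v).2⌋ + 1 ≤ (n : ℤ))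
  have h6 := Int.lt_floor_add_one (q - v).1
  have h7 := Int.lt_floor_add_one (q - v).2
  simp only [Prod.fst_sub, Prod.snd_sub] at h1 h2 h4 h5 h6 h7
  refine ⟨⟨?_, ?_⟩, ⟨?_, ?_⟩⟩ <;>
    simp only [Prod.fst_sub, Prod.snd_sub, Prod.fst_add, Prod.snd_add] <;> linarith

theorem HasCovolume.eventually_separated {L : Submodule ℤ Plane} {D : ℝ} (hL : HasCovolume L D) :
    ∀ᶠ ε in nhdsWithin (0 : ℝ) (Set.Ioi 0), ∀ v ∈ L, |v.1| < ε → |v.2| < ε → v = 0 := by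
  have hfin : ({v | v ∈ L ∧ v ∈ Set.Icc (-1 : Plane) 1} : Set Plane).Finite :=
    hL.finite_of_bounded (fun v hv => hv.1)
      ((Metric.isBounded_Icc (-1 : Plane) 1).subset fun v hv => hv.2)
  have hev : ∀ v ∈ ({v | v ∈ L ∧ v ∈ Set.Icc (-1 : Plane) 1} : Set Plane),
      ∀ᶠ ε in nhdsWithin (0 : ℝ) (Set.Ioi 0), |v.1| < ε → |v.2| < ε → v = 0 := by
    intro v _
    by_cases h0 : v = 0
    · exact Eventually.of_forall fun _ _ _ => h0
    · have hpos : 0 < max |v.1| |v.2| := by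
        rw [lt_max_iff, abs_pos, abs_pos]
        by_contra! h
        exact h0 (Prod.ext h.1 h.2)
      filter_upwards [nhdsWithin_le_nhds (eventually_lt_nhds hpos)] with ε hε h1 h2
      exact absurd (max_lt h1 h2) hε.not_gt
  filter_upwards [(Filter.eventually_all_finite hfin).mpr hev,
    nhdsWithin_le_nhds (eventually_lt_nhds one_pos)] with ε hε hε1 v hv h1 h2
  have h1' := abs_lt.mp h1
  have h2' := abs_lt.mp h2
  refine hε v ⟨hv, ⟨?_, ?_⟩, ⟨?_, ?_⟩⟩ h1 h2
  · change -1 ≤ v.1; linarith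
  · change -1 ≤ v.2; linarith
  · change v.1 ≤ 1; linarith
  · change v.2 ≤ 1; linarith

/-- A packing by staircases without loss of area covers every point exactly `j` times: a
deficient point has a deficient box next to it, which could be added to the staircase. -/
theorem HasCovolume.staircase_encard_eq {L : Submodule ℤ Plane} {D : ℝ} (hL : HasCovolume L D)
    {n j : ℕ} (hle : ∀ p, ({v | v ∈ L ∧ p - v ∈ staircase n} : Set Plane).encard ≤ j)
    (hvol : j * ENNReal.ofReal D ≤ volume (staircase n)) (p : Plane) :
    ({v | v ∈ L ∧ p - v ∈ staircase n} : Set Plane).encard = j := by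
  by_contra hne
  have hlt := lt_of_le_of_ne (hle p) hne
  obtain ⟨ε, ⟨hε1, hε2⟩, hε0⟩ :=
    (((hL.eventually_staircase n p).and hL.eventually_separated).and self_mem_nhdsWithin).exists
  replace hε0 : 0 < ε := hε0
  set U : Set Plane := Set.Ico p.1 (p.1 + ε) ×ˢ Set.Ico p.2 (p.2 + ε) with hU
  have hUm : MeasurableSet U := measurableSet_Ico.prod measurableSet_Ico
  have hUpos : volume U ≠ 0 := by
    rw [hU, Measure.volume_eq_prod, Measure.prod_prod, Real.volume_Ico, Real.volume_Ico]
    simp [hε0]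
  have hSm := measurableSet_staircase n
  have hone : ∀ q, ({v | v ∈ L ∧ q - v ∈ U} : Set Plane).encard ≤ 1 := by
    intro q
    rw [Set.encard_le_one_iff]
    rintro v w ⟨hv, hv1, hv2⟩ ⟨hw, hw1, hw2⟩
    simp only [Set.mem_Ico, Prod.fst_sub, Prod.snd_sub] at hv1 hv2 hw1 hw2
    have := hε2 (v - w) (L.sub_mem hv hw)
      (by simp only [Prod.fst_sub, abs_lt]; constructor <;> linarith)
      (by simp only [Prod.snd_sub, abs_lt]; constructor <;> linarith)
    exact sub_eq_zero.mp this
  have hsum : ∀ q, ({v | v ∈ L ∧ q - v ∈ staircase n} : Set Plane).encard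
      + ({v | v ∈ L ∧ q - v ∈ U} : Set Plane).encard ≤ j := by
    intro q
    rcases ({v | v ∈ L ∧ q - v ∈ U} : Set Plane).eq_empty_or_nonempty with h0 | ⟨v₀, hv₀, hq⟩
    · rw [h0, Set.encard_empty, add_zero]
      exact hle q
    · have hsub : (fun v => v - v₀) '' {v | v ∈ L ∧ q - v ∈ staircase n}
          ⊆ {v | v ∈ L ∧ p - v ∈ staircase n} := by
        rintro _ ⟨v, ⟨hv, hvq⟩, rfl⟩
        refine ⟨L.sub_mem hv hv₀, hε1 (q - v₀) hq.1.1 hq.1.2 hq.2.1 hq.2.2 _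
          (L.sub_mem hv hv₀) ?_⟩
        simpa using hvq
      have h1 := (Set.encard_le_encard hsub).trans_lt hlt
      rw [(sub_left_injective (b := v₀)).encard_image] at h1
      exact (add_le_add le_rfl (hone q)).trans (Order.add_one_le_of_lt h1)
  have hint := hL.lintegral_le (f := fun x => (staircase n).indicator 1 x + U.indicator 1 x)
    (k := j) ((measurable_one.indicator hSm).add (measurable_one.indicator hUm)) (by
      intro q
      rw [ENNReal.tsum_add, tsum_indicator_translates, tsum_indicator_translates]
      exact_mod_cast ENat.toENNReal_le.mpr (hsum q))
  rw [lintegral_add_left (measurable_one.indicator hSm), lintegral_indicator_one hSm,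
    lintegral_indicator_one hUm] at hint
  have hfin : volume (staircase n) ≠ ∞ := by
    refine ne_top_of_le_ne_top ?_ (le_self_add.trans hint)
    exact ENNReal.mul_ne_top (ENNReal.natCast_ne_top j) ENNReal.ofReal_ne_top
  have h2 : volume (staircase n) + volume U ≤ volume (staircase n) + 0 := by
    rw [add_zero]
    exact hint.trans hvol
  exact hUpos (le_antisymm ((ENNReal.add_le_add_iff_left hfin).mp h2) bot_le)

/-- The covolume bound for `j`-fold packings of triangles with legs `2 j`. In the case of equality
the translates of the staircase of the same size form an exact `j`-fold tiling. -/
theorem HasCovolume.bound_of_packing {L : Submodule ℤ Plane} {D : ℝ} (hL : HasCovolume L D)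
    {j : ℕ} (hj : 1 ≤ j)
    (hpack : ∀ x : Plane,
      ({v | v ∈ L ∧ (0 < x.1 - v.1 ∧ 0 < x.2 - v.2 ∧ x.1 - v.1 + (x.2 - v.2) < 2 * j)} :
        Set Plane).encard ≤ j) :
    2 * (j : ℝ) + 1 ≤ D ∧ (D = 2 * (j : ℝ) + 1 → ∀ p,
      ({v | v ∈ L ∧ p - v ∈ staircase (2 * j)} : Set Plane).encard = j) := by
  have hj' : (1 : ℝ) ≤ j := by exact_mod_cast hj
  have hYfin : (stepHeights L j).Finite :=
    Set.finite_of_encard_le_coe (encard_stepHeights_le L j)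
  set Y := hYfin.toFinset with hYdef
  have hYcard : Y.card ≤ 2 * j := by
    have := encard_stepHeights_le L j
    rw [hYfin.encard_eq_coe_toFinset_card] at this
    exact_mod_cast this
  have hG : unblockedRegion (2 * j : ℕ) Y ⊆ lowRegion L j := by
    have htri : ∀ x : Plane, 0 ≤ x.1 → 0 ≤ x.2 → x.1 + x.2 < 2 * j → x ∈ lowRegion L j :=
      fun x => mem_lowRegion_of_packing hpack
    rintro x (⟨h1, h2, h3⟩ | ⟨⟨h1, h2, h3, h4⟩, hU⟩)
    · exact htri x h1 h2 (by push_cast at h3; linarith)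
    · push_cast at h2 h3 h4
      by_contra hx
      obtain ⟨η, hη, hη1, hη2⟩ := exists_stepHeight hL hj (t := 2 * j - x.1) (by linarith) hx h1
        (by linarith) (fun y hy hyt => htri _ h1 hy (by simp only; linarith))
      refine hU (Set.mem_iUnion₂.mpr ⟨η, by simpa [hYdef] using hη, ?_, hη2, ?_⟩)
      · push_cast; linarith
      · push_cast; linarith
  have hvolG : volume (unblockedRegion (2 * j : ℕ) Y) ≤ j * ENNReal.ofReal D :=
    hL.volume_le (measurableSet_unblockedRegion _ _) (encard_le_of_subset_lowRegion L hG)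
  have hval : ((2 * j : ℕ) : ℝ) ^ 2 / 2 + ((2 * j : ℕ) : ℝ) / 2 = j * (2 * (j : ℝ) + 1) := by
    push_cast; ring
  have hjD : (j : ℝ≥0∞) * ENNReal.ofReal D = ENNReal.ofReal (j * D) := by
    rw [ENNReal.ofReal_mul (by positivity), ENNReal.ofReal_natCast]
  constructor
  · have h := (volume_unblockedRegion_ge hYcard).trans hvolG
    rw [hval, hjD, ENNReal.ofReal_le_ofReal_iff (by have := hL.pos; positivity)] at h
    exact le_of_mul_le_mul_left h (by linarith)
  · rintro rfl
    have hint := exists_int_eq_of_minimal hYcard (by rw [hval, ← hjD]; exact hvolG)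
    have hsub := (staircase_subset_unblockedRegion hint).trans hG
    refine hL.staircase_encard_eq (encard_le_of_subset_lowRegion L hsub) ?_
    rw [hjD, ← hval]
    exact volume_staircase_ge _

/-! ### Edges of exact tilings by staircases -/

theorem mem_staircase_of_le {n : ℕ} {q q' : Plane} (hq : q ∈ staircase n) (h1 : 0 ≤ q'.1)
    (h2 : 0 ≤ q'.2) (h3 : q'.1 ≤ q.1) (h4 : q'.2 ≤ q.2) : q' ∈ staircase n :=
  ⟨h1, h2, lt_of_le_of_lt
    (add_le_add (Int.floor_le_floor h3) (Int.floor_le_floor h4)) hq.2.2⟩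

theorem lt_of_mem_staircase {n : ℕ} {q : Plane} (hq : q ∈ staircase n) : q.1 < n ∧ q.2 < n := by
  obtain ⟨h1, h2, h3⟩ := hq
  have hf1 : 0 ≤ ⌊q.1⌋ := Int.floor_nonneg.mpr h1
  have hf2 : 0 ≤ ⌊q.2⌋ := Int.floor_nonneg.mpr h2
  have h4 : (⌊q.1⌋ : ℝ) + 1 ≤ n := by exact_mod_cast (by omega : ⌊q.1⌋ + 1 ≤ (n : ℤ))
  have h5 : (⌊q.2⌋ : ℝ) + 1 ≤ n := by exact_mod_cast (by omega : ⌊q.2⌋ + 1 ≤ (n : ℤ))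
  exact ⟨(Int.lt_floor_add_one _).trans_le h4, (Int.lt_floor_add_one _).trans_le h5⟩

/-- In an exact tiling by staircases, every point of a right edge of the staircase lies on the left
edge of a translate: crossing the right edge from left to right, the multiplicity would drop
otherwise. -/
theorem exists_leftEdge {L : Submodule ℤ Plane} {n j : ℕ}
    (hex : ∀ p, ({v | v ∈ L ∧ p - v ∈ staircase n} : Set Plane).encard = j)
    {i : ℕ} (hi1 : 1 ≤ i) (hin : i ≤ n) {r : ℝ} (hr0 : 0 ≤ r) (hr1 : r < 1) :
    ∃ η : ℝ, ((i : ℝ), η) ∈ L ∧ -i + r < η ∧ η ≤ n - i + r := by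
  by_contra! hcon
  set p : Plane := ((i : ℝ), n - i + r) with hp
  set F : Set Plane := {v | v ∈ L ∧ p - v ∈ staircase n} with hF
  have hFfin : F.Finite := Set.finite_of_encard_eq_coe (hex p)
  have hinR : (i : ℝ) ≤ n := by exact_mod_cast hin
  have hev : ∀ v ∈ F, ∀ᶠ ε in nhdsWithin (0 : ℝ) (Set.Ioi 0), p - (ε, 0) - v ∈ staircase n := by
    rintro v ⟨hv, hq⟩
    have hpos : 0 < (p - v).1 := by
      refine lt_of_le_of_ne hq.1 fun h0 => ?_
      have hv1 : v.1 = i := by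
        simp only [hp, Prod.fst_sub] at h0
        linarith
      have h2 := hq.2.1
      have h3 := (lt_of_mem_staircase hq).2
      simp only [hp, Prod.snd_sub] at h2 h3
      have := hcon v.2 (by rw [← hv1]; exact hv) (by linarith)
      linarith
    filter_upwards [nhdsWithin_le_nhds (eventually_lt_nhds hpos), self_mem_nhdsWithin]
      with ε hε hε0
    replace hε0 : 0 < ε := hε0
    have h2 := hq.2.1
    simp only [Prod.fst_sub, Prod.snd_sub] at hε h2
    refine mem_staircase_of_le hq ?_ ?_ ?_ ?_ <;> simp only [Prod.fst_sub, Prod.snd_sub] <;>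
      linarith
  obtain ⟨ε, ⟨hε, hε1⟩, hε0⟩ := (((Filter.eventually_all_finite hFfin).mpr hev).and
    (nhdsWithin_le_nhds (eventually_lt_nhds one_pos)) |>.and self_mem_nhdsWithin).exists
  replace hε0 : 0 < ε := hε0
  have hi1R : (1 : ℝ) ≤ i := by exact_mod_cast hi1
  have hfl2 : ⌊(n : ℝ) - i + r⌋ = (n : ℤ) - i := by
    rw [Int.floor_eq_iff]; push_cast; constructor <;> linarith
  have h0 : (0 : Plane) ∉ F := by
    rintro ⟨-, -, -, h⟩
    rw [sub_zero, hp, hfl2, Int.floor_natCast] at h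
    omega
  have hsub : insert 0 F ⊆ ({v | v ∈ L ∧ p - (ε, 0) - v ∈ staircase n} : Set Plane) := by
    rintro v (rfl | hv)
    · refine ⟨L.zero_mem, ?_⟩
      have hfl1 : ⌊(i : ℝ) - ε⌋ = (i : ℤ) - 1 := by
        rw [Int.floor_eq_iff]; push_cast; constructor <;> linarith
      rw [sub_zero, hp]
      refine ⟨?_, ?_, ?_⟩ <;> simp only [Prod.fst_sub, Prod.snd_sub, sub_zero]
      · linarith
      · linarith
      · rw [hfl1, hfl2]; omega
    · exact ⟨hv.1, hε v hv⟩
  have h := Set.encard_le_encard hsub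
  rw [Set.encard_insert_of_notMem h0, hex, hex] at h
  have : j + 1 ≤ j := by exact_mod_cast h
  omega

/-- The half-open rectangle `[0, 1) × [0, t)`. -/
def column (t : ℝ) : Set Plane := Set.Ico 0 1 ×ˢ Set.Ico 0 t

theorem measurableSet_column (t : ℝ) : MeasurableSet (column t) :=
  measurableSet_Ico.prod measurableSet_Ico

theorem volume_column (t : ℝ) : volume (column t) = ENNReal.ofReal t := by
  rw [column, Measure.volume_eq_prod, Measure.prod_prod, Real.volume_Ico, Real.volume_Ico]
  simp

theorem exists_sub_mem_column (s : ℝ) {t : ℝ} (ht : 0 < t) (p : Plane) :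
    ∃ v ∈ Submodule.span ℤ {((1, s) : Plane), ((0, t) : Plane)}, p - v ∈ column t := by
  refine ⟨_, Submodule.mem_span_pair.mpr ⟨⌊p.1⌋, ⌊(p.2 - ⌊p.1⌋ * s) / t⌋, rfl⟩, ?_⟩
  have h1 := Int.floor_le p.1
  have h2 := Int.lt_floor_add_one p.1
  have h3 := (le_div_iff₀ ht).mp (Int.floor_le ((p.2 - ⌊p.1⌋ * s) / t))
  have h4 := (div_lt_iff₀ ht).mp (Int.lt_floor_add_one ((p.2 - ⌊p.1⌋ * s) / t))
  simp only [column, Set.mem_prod, Set.mem_Ico, Prod.fst_sub, Prod.snd_sub, Prod.fst_add,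
    Prod.snd_add, Prod.smul_mk, zsmul_eq_mul, mul_one, mul_zero, add_zero]
  refine ⟨⟨by linarith, by linarith⟩, ⟨by linarith, by linarith⟩⟩

theorem HasCovolume.le_of_vertical {L : Submodule ℤ Plane} {D : ℝ} (hL : HasCovolume L D)
    {s t : ℝ} (hs : ((1, s) : Plane) ∈ L) (ht0 : 0 < t) (ht : ((0, t) : Plane) ∈ L) : D ≤ t := by
  have hsub : Submodule.span ℤ {((1, s) : Plane), ((0, t) : Plane)} ≤ L :=
    Submodule.span_le.mpr (by rintro v (rfl | rfl) <;> assumption)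
  have h := hL.le_volume (measurableSet_column t) (k := 1) (by
    intro p
    obtain ⟨v, hv, hp⟩ := exists_sub_mem_column s ht0 p
    rw [Nat.cast_one, Set.one_le_encard_iff_nonempty]
    exact ⟨v, hsub hv, hp⟩)
  rw [volume_column, Nat.cast_one, one_mul, ENNReal.ofReal_le_ofReal_iff ht0.le] at h
  exact h

/-- Two vectors `(1, s)` and `(0, t)` of a lattice of covolume `D` generate the lattice if
`t < 2 D`, for a further vector would make the translates of `[0, 1) × [0, t)` cover the plane
twice. -/
theorem HasCovolume.eq_span_of_lt {L : Submodule ℤ Plane} {D : ℝ} (hL : HasCovolume L D)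
    {s t : ℝ} (hs : ((1, s) : Plane) ∈ L) (ht0 : 0 < t) (ht : ((0, t) : Plane) ∈ L)
    (htD : t < 2 * D) : L = Submodule.span ℤ {((1, s) : Plane), ((0, D) : Plane)} := by
  have hsub : Submodule.span ℤ {((1, s) : Plane), ((0, t) : Plane)} ≤ L :=
    Submodule.span_le.mpr (by rintro v (rfl | rfl) <;> assumption)
  have heq : L = Submodule.span ℤ {((1, s) : Plane), ((0, t) : Plane)} := by
    refine le_antisymm ?_ hsub
    by_contra hnot
    obtain ⟨u, hu, hu'⟩ := SetLike.not_le_iff_exists.mp hnot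
    have h := hL.le_volume (measurableSet_column t) (k := 2) (by
      intro p
      obtain ⟨v, hv, hp⟩ := exists_sub_mem_column s ht0 p
      obtain ⟨w, hw, hq⟩ := exists_sub_mem_column s ht0 (p - u)
      have hne : v ≠ u + w := by
        rintro rfl
        exact hu' (by simpa using Submodule.sub_mem _ hv hw)
      rw [Nat.cast_ofNat, ← Set.encard_pair hne]
      refine Set.encard_le_encard ?_
      rintro x (rfl | rfl)
      · exact ⟨hsub hv, hp⟩
      · exact ⟨L.add_mem hu (hsub hw), by rwa [← sub_sub]⟩)
    rw [volume_column, ← ENNReal.ofReal_natCast, ← ENNReal.ofReal_mul (by positivity),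
      ENNReal.ofReal_le_ofReal_iff ht0.le] at h
    push_cast at h
    linarith
  have hle : t ≤ D := by
    have h := hL.volume_le (measurableSet_column t) (k := 1) (by
      intro p
      rw [Nat.cast_one, Set.encard_le_one_iff]
      rintro v w ⟨hv, ⟨hv1, hv2⟩, hv3, hv4⟩ ⟨hw, ⟨hw1, hw2⟩, hw3, hw4⟩
      have hd := L.sub_mem hv hw
      rw [heq, Submodule.mem_span_pair] at hd
      obtain ⟨a, b, hab⟩ := hd
      have e1 : (a : ℝ) = v.1 - w.1 := by simpa using congrArg Prod.fst hab
      have e2 : a * s + b * t = v.2 - w.2 := by simpa using congrArg Prod.snd hab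
      simp only [Prod.fst_sub, Prod.snd_sub] at hv1 hv2 hv3 hv4 hw1 hw2 hw3 hw4
      have ha : a = 0 := by
        have h1 : (a : ℝ) < 1 := by linarith
        have h2 : (-1 : ℝ) < a := by linarith
        have h1' : a < 1 := by exact_mod_cast h1
        have h2' : -1 < a := by exact_mod_cast h2
        omega
      subst ha
      have hb : b = 0 := by
        have h1 : (b : ℝ) * t < 1 * t := by push_cast at e2; linarith
        have h2 : (-1 : ℝ) * t < b * t := by push_cast at e2; linarith
        have h1' : b < 1 := by exact_mod_cast lt_of_mul_lt_mul_right h1 ht0.le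
        have h2' : -1 < b := by exact_mod_cast lt_of_mul_lt_mul_right h2 ht0.le
        omega
      subst hb
      push_cast at e1 e2
      exact Prod.ext (by linarith) (by linarith))
    rw [volume_column, Nat.cast_one, one_mul, ENNReal.ofReal_le_ofReal_iff hL.pos.le] at h
    exact h
  have := le_antisymm hle (hL.le_of_vertical hs ht0 ht)
  rwa [this] at heq

/-- A lattice of covolume `2 j + 1` that gives an exact `j`-fold tiling by staircases has a basis
of the form `(1, s)`, `(0, 2 j + 1)`. -/
theorem HasCovolume.eq_span_of_exact {L : Submodule ℤ Plane} {j : ℕ}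
    (hL : HasCovolume L (2 * j + 1)) (hj : 1 ≤ j)
    (hex : ∀ p, ({v | v ∈ L ∧ p - v ∈ staircase (2 * j)} : Set Plane).encard = j) :
    ∃ s : ℝ, 0 < s ∧ s ≤ 2 * j - 1 ∧
      L = Submodule.span ℤ {((1, s) : Plane), ((0, 2 * (j : ℝ) + 1) : Plane)} := by
  have hjR : (1 : ℝ) ≤ j := by exact_mod_cast hj
  obtain ⟨s, hs, hs1, hs2⟩ := exists_leftEdge hex le_rfl (by omega) le_rfl one_pos
  push_cast at hs hs1 hs2
  have hvert : ∀ t : ℝ, 0 < t → ((0, t) : Plane) ∈ L → 2 * (j : ℝ) + 1 ≤ t := fun t ht0 ht =>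
    hL.le_of_vertical hs ht0 ht
  have hs0 : 0 ≤ s := by
    by_contra! hneg
    obtain ⟨η, hη, h1, h2⟩ := exists_leftEdge hex le_rfl (by omega) (r := s + 1)
      (by linarith) (by linarith)
    push_cast at hη h1 h2
    have hmem : ((0, η - s) : Plane) ∈ L := by simpa using L.sub_mem hη hs
    have := hvert (η - s) (by linarith) hmem
    linarith
  have hspos : 0 < s := by
    refine lt_of_le_of_ne hs0 fun h0 => ?_
    -- otherwise `(1, 0)` is a lattice vector, and the staircase contains more than `j` of its
    -- multiples
    rw [← h0] at hs
    have hsub : (fun i : ℕ => (((i : ℝ), 0) : Plane)) '' (Finset.range (j + 1) : Set ℕ)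
        ⊆ {v | v ∈ L ∧ (((j : ℝ), 0) : Plane) - v ∈ staircase (2 * j)} := by
      rintro _ ⟨i, hi, rfl⟩
      have hij : i ≤ j := by simpa [Nat.lt_succ_iff] using hi
      refine ⟨by simpa using L.smul_mem (i : ℤ) hs, ?_⟩
      have hc : (((j : ℝ), 0) : Plane) - ((i : ℝ), 0) = (((j - i : ℕ) : ℝ), 0) := by
        simp [Nat.cast_sub hij]
      rw [hc]
      refine ⟨by positivity, le_rfl, ?_⟩
      simp only [Int.floor_natCast, Int.floor_zero]
      omega
    have h := Set.encard_le_encard hsub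
    rw [hex, Function.Injective.encard_image (fun a b hab => by simpa using hab),
      Set.encard_coe_eq_coe_finsetCard, Finset.card_range] at h
    have : j + 1 ≤ j := by exact_mod_cast h
    omega
  refine ⟨s, hspos, by linarith, ?_⟩
  -- the first multiple of `s + 1` that exceeds `2 j`
  set i := ⌊2 * (j : ℝ) / (s + 1)⌋₊ + 1 with hi
  have hfl1 := Nat.floor_le (a := 2 * (j : ℝ) / (s + 1)) (by positivity)
  have hfl2 := Nat.lt_floor_add_one (2 * (j : ℝ) / (s + 1))
  rw [le_div_iff₀ (by linarith)] at hfl1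
  rw [div_lt_iff₀ (by linarith)] at hfl2
  have hilt : ⌊2 * (j : ℝ) / (s + 1)⌋₊ < 2 * j := by
    rw [Nat.floor_lt (by positivity), div_lt_iff₀ (by linarith)]
    push_cast
    nlinarith
  have hiR : (i : ℝ) = ⌊2 * (j : ℝ) / (s + 1)⌋₊ + 1 := by rw [hi]; push_cast; rfl
  obtain ⟨η, hη, h1, h2⟩ := exists_leftEdge hex (i := i) (by omega) (by omega) le_rfl one_pos
  push_cast at h1 h2
  have hmem : ((0, i * s - η) : Plane) ∈ L := by
    simpa using L.sub_mem (L.smul_mem (i : ℤ) hs) hη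
  refine hL.eq_span_of_lt hs ?_ hmem ?_
  · rw [← hiR] at hfl2
    linarith
  · have : (i : ℝ) * (s + 1) ≤ 2 * j + (s + 1) := by rw [hiR]; linarith
    linarith

/-! ### Arithmetic of the extremal lattices -/

theorem HasCovolume.exists_swap {L : Submodule ℤ Plane} {D : ℝ} (hL : HasCovolume L D) :
    ∃ L' : Submodule ℤ Plane, HasCovolume L' D ∧ ∀ v, v ∈ L' ↔ v.swap ∈ L := by
  obtain ⟨u, w, rfl, hD, hpos⟩ := hL
  refine ⟨_, ⟨u.swap, w.swap, rfl, ?_, hpos⟩, fun v => ?_⟩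
  · rw [← hD, ← abs_neg]
    congr 1
    simp only [Prod.fst_swap, Prod.snd_swap]
    ring
  · simp only [Submodule.mem_span_pair]
    constructor <;> rintro ⟨a, b, h⟩ <;> refine ⟨a, b, ?_⟩
    · rw [← h]; rfl
    · rw [← v.swap_swap, ← h]; rfl

theorem swap_mem_staircase {n : ℕ} {q : Plane} : q.swap ∈ staircase n ↔ q ∈ staircase n := by
  simp only [staircase, Set.mem_ofPred_eq, Prod.fst_swap, Prod.snd_swap, add_comm ⌊q.2⌋]
  tauto

theorem mem_span_one_zero {s t : ℝ} {v : Plane} :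
    v ∈ Submodule.span ℤ {((1, s) : Plane), ((0, t) : Plane)} ↔
      ∃ a b : ℤ, v.1 = a ∧ v.2 = a * s + b * t := by
  rw [Submodule.mem_span_pair]
  constructor
  · rintro ⟨a, b, rfl⟩
    exact ⟨a, b, by simp, by simp⟩
  · rintro ⟨a, b, h1, h2⟩
    exact ⟨a, b, Prod.ext (by simp [h1]) (by simp [h2])⟩

/-- The lattices of covolume `2 j + 1` that give an exact `j`-fold tiling by staircases. -/
theorem HasCovolume.exists_nat_of_exact {L : Submodule ℤ Plane} {j : ℕ}
    (hL : HasCovolume L (2 * j + 1)) (hj : 1 ≤ j)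
    (hex : ∀ p, ({v | v ∈ L ∧ p - v ∈ staircase (2 * j)} : Set Plane).encard = j) :
    ∃ m : ℕ, 1 ≤ m ∧ m ≤ 2 * j + 1 ∧ Nat.gcd m (2 * j + 1) = 1 ∧
      Nat.gcd (m + 1) (2 * j + 1) = 1 ∧
      L = Submodule.span ℤ {((1, (m : ℝ)) : Plane), ((0, 2 * (j : ℝ) + 1) : Plane)} := by
  have hjR : (1 : ℝ) ≤ j := by exact_mod_cast hj
  obtain ⟨s, hs0, hs1, hspan⟩ := hL.eq_span_of_exact hj hex
  obtain ⟨L', hL', hswap⟩ := hL.exists_swap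
  have hex' : ∀ p, ({v | v ∈ L' ∧ p - v ∈ staircase (2 * j)} : Set Plane).encard = j := by
    intro p
    rw [← hex p.swap, ← Prod.swap_injective.encard_image]
    congr 1
    ext v
    constructor
    · rintro ⟨w, ⟨hw, hq⟩, rfl⟩
      exact ⟨(hswap w).mp hw, swap_mem_staircase.mpr hq⟩
    · rintro ⟨hv, hq⟩
      exact ⟨v.swap, ⟨(hswap _).mpr (by simpa using hv), swap_mem_staircase.mp (by simpa using hq)⟩,
        v.swap_swap⟩
  obtain ⟨s', -, -, hspan'⟩ := hL'.eq_span_of_exact hj hex'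
  have hmem : ∀ v : Plane, v ∈ L ↔ ∃ a b : ℤ, v.1 = a ∧ v.2 = a * s + b * (2 * (j : ℝ) + 1) := by
    intro v; rw [hspan]; exact mem_span_one_zero
  -- the lattice vector `(2 j + 1, 0)` shows that `s` is an integer
  have h1 : ((2 * (j : ℝ) + 1, 0) : Plane) ∈ L := by
    have : ((0, 2 * (j : ℝ) + 1) : Plane) ∈ L' := by
      rw [hspan']; exact Submodule.subset_span (by simp)
    exact (hswap _).mp this
  obtain ⟨a, b, ha, hb⟩ := (hmem _).mp h1
  simp only at ha hb
  rw [← ha] at hb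
  have hsb : s = -b := by
    have : (2 * (j : ℝ) + 1) * (s + b) = 0 := by linarith
    have := (mul_eq_zero.mp this).resolve_left (by linarith)
    linarith
  obtain ⟨m, hm⟩ : ∃ m : ℕ, (m : ℤ) = -b := by
    have : (0 : ℝ) < ((-b : ℤ) : ℝ) := by push_cast; linarith
    have : 0 < -b := by exact_mod_cast this
    exact ⟨(-b).toNat, by omega⟩
  have hsm : s = m := by
    rw [hsb]
    have : ((m : ℤ) : ℝ) = ((-b : ℤ) : ℝ) := by rw [hm]
    push_cast at this
    exact this.symm
  subst hsm
  refine ⟨m, by exact_mod_cast hs0, ?_, ?_, ?_, hspan⟩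
  · have : (m : ℝ) ≤ ((2 * j + 1 : ℕ) : ℝ) := by push_cast; linarith
    exact_mod_cast this
  · -- the lattice contains a vector of ordinate `1`
    have h2 : ((s', 1) : Plane) ∈ L := by
      have : ((1, s') : Plane) ∈ L' := by
        rw [hspan']; exact Submodule.subset_span (by simp)
      exact (hswap _).mp this
    obtain ⟨a, b, -, hb⟩ := (hmem _).mp h2
    have hb' : (1 : ℤ) = a * m + b * (2 * j + 1 : ℕ) := by
      simp only at hb
      exact_mod_cast hb
    have hc : IsCoprime (m : ℤ) ((2 * j + 1 : ℕ) : ℤ) := ⟨a, b, hb'.symm⟩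
    exact Nat.isCoprime_iff_coprime.mp hc
  · -- a common divisor `g` gives a multiple of `2 j + 1` strictly between `0` and `2 j + 1`
    by_contra hg
    set g := Nat.gcd (m + 1) (2 * j + 1) with hgdef
    have hg0 : 0 < g := Nat.gcd_pos_of_pos_left _ (by omega)
    obtain ⟨i, hi⟩ : g ∣ 2 * j + 1 := Nat.gcd_dvd_right _ _
    obtain ⟨e, he⟩ : g ∣ m + 1 := Nat.gcd_dvd_left _ _
    have hg2 : 2 ≤ g := by omega
    have hi1 : 1 ≤ i := by
      rcases Nat.eq_zero_or_pos i with rfl | h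
      · omega
      · exact h
    have hi2 : i ≤ 2 * j := by nlinarith
    obtain ⟨η, hη, hη1, hη2⟩ := exists_leftEdge hex hi1 hi2 le_rfl one_pos
    obtain ⟨a, b, ha, hb⟩ := (hmem _).mp hη
    simp only at ha hb
    rw [← ha] at hb
    have hie : (i : ℤ) * (m + 1) = e * (2 * j + 1) := by
      have h3 : ((m : ℤ) + 1) = g * e := by exact_mod_cast he
      have h4 : (2 * (j : ℤ) + 1) = g * i := by exact_mod_cast hi
      rw [h3, h4]; ring
    have hieR : (i : ℝ) * (m + 1) = e * (2 * j + 1) := by exact_mod_cast hie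
    push_cast at hη1 hη2
    have hlow : (0 : ℝ) < (e + b) * (2 * j + 1) := by linarith
    have hupp : ((e : ℝ) + b) * (2 * j + 1) < 1 * (2 * j + 1) := by linarith
    have h5 : (0 : ℝ) < (e : ℝ) + b := pos_of_mul_pos_left hlow (by linarith)
    have h6 : (e : ℝ) + b < 1 := lt_of_mul_lt_mul_right hupp (by linarith)
    have h5' : (0 : ℤ) < e + b := by exact_mod_cast h5
    have h6' : (e : ℤ) + b < 1 := by exact_mod_cast h6
    omega

theorem sum_val_zmod (j : ℕ) : ∑ a : ZMod (2 * j + 1), a.val = (2 * j + 1) * j := by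
  have h : ∑ a : ZMod (2 * j + 1), a.val = ∑ i ∈ Finset.range (2 * j + 1), i :=
    Fin.sum_univ_eq_sum_range (fun i => i) (2 * j + 1)
  have h2 := Finset.sum_range_id_mul_two (2 * j + 1)
  rw [h]
  simp only [Nat.add_sub_cancel] at h2
  nlinarith

theorem sum_val_affine {j : ℕ} {m : ZMod (2 * j + 1)} (hm : IsUnit m) (c : ZMod (2 * j + 1)) :
    ∑ a : ZMod (2 * j + 1), (m * a + c).val = (2 * j + 1) * j := by
  rw [← sum_val_zmod j]
  obtain ⟨u, rfl⟩ := hm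
  exact Equiv.sum_comp (u.mulLeft.trans (Equiv.addRight c)) (fun a => a.val)

/-- The points of a coset of the lattice in the staircase are counted by summing the identity
`a + b = r + (2 j + 1) · carry` over all residues `a`, where `b` and `r` are the residues of
`m a + c` and `(m + 1) a + c`: all three sums of residues agree, so there are exactly `j`
carries. -/
theorem card_filter_val_add_val_le {j : ℕ} {m : ZMod (2 * j + 1)} (hm : IsUnit m)
    (hm1 : IsUnit (m + 1)) (c : ZMod (2 * j + 1)) :
    (Finset.univ.filter fun a : ZMod (2 * j + 1) => a.val + (m * a + c).val < 2 * j).card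
      ≤ j := by
  classical
  set K := Finset.univ.filter fun a : ZMod (2 * j + 1) => 2 * j + 1 ≤ a.val + (m * a + c).val
    with hK
  have hcarry : ∀ a : ZMod (2 * j + 1), a.val + (m * a + c).val
      = ((m + 1) * a + c).val
        + (2 * j + 1) * (if 2 * j + 1 ≤ a.val + (m * a + c).val then 1 else 0) := by
    intro a
    have he : (m + 1) * a + c = a + (m * a + c) := by ring
    rw [he]
    split_ifs with h
    · rw [ZMod.val_add_val_of_le h, mul_one]
    · rw [ZMod.val_add_of_lt (not_le.mp h), mul_zero, add_zero]
  have hsum := Finset.sum_congr rfl (fun a (_ : a ∈ (Finset.univ : Finset (ZMod (2 * j + 1)))) =>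
    hcarry a)
  rw [Finset.sum_add_distrib, Finset.sum_add_distrib, sum_val_zmod, sum_val_affine hm,
    sum_val_affine hm1, ← Finset.mul_sum, Finset.sum_boole] at hsum
  have hKcard : K.card = j := by
    have h : (2 * j + 1) * j = (2 * j + 1) * K.card := by
      have := Nat.add_left_cancel hsum
      simpa [hK] using this
    exact (Nat.eq_of_mul_eq_mul_left (by omega) h).symm
  -- the residue `a₀` with `(m + 1) a₀ + c = -1` lies on the line `a + b = 2 j`
  obtain ⟨a₀, ha₀⟩ : ∃ a₀ : ZMod (2 * j + 1), (m + 1) * a₀ + c = -1 := by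
    obtain ⟨u, hu⟩ := hm1
    refine ⟨↑u⁻¹ * (-1 - c), ?_⟩
    rw [← hu, Units.mul_inv_cancel_left]
    ring
  have h0 : a₀.val + (m * a₀ + c).val = 2 * j := by
    have h := hcarry a₀
    rw [ha₀, ZMod.val_neg_one] at h
    split_ifs at h with hle
    · have h1 := ZMod.val_lt a₀
      have h2 := ZMod.val_lt (m * a₀ + c)
      omega
    · omega
  have hsub : (Finset.univ.filter fun a : ZMod (2 * j + 1) => a.val + (m * a + c).val < 2 * j)
      ⊆ (Finset.univ \ K).erase a₀ := by
    intro a ha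
    rw [Finset.mem_filter] at ha
    rw [Finset.mem_erase, Finset.mem_sdiff, hK, Finset.mem_filter]
    refine ⟨?_, Finset.mem_univ _, fun h => by omega⟩
    rintro rfl
    omega
  have hcard := Finset.card_le_card hsub
  rw [Finset.card_erase_of_mem, Finset.card_sdiff_of_subset (Finset.subset_univ K), hKcard,
    Finset.card_univ, ZMod.card] at hcard
  · omega
  · rw [Finset.mem_sdiff, hK, Finset.mem_filter]
    exact ⟨Finset.mem_univ _, fun h => by omega⟩

theorem isUnit_of_gcd_eq_one {m N : ℕ} (h : Nat.gcd m N = 1) : IsUnit (m : ZMod N) :=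
  (ZMod.isUnit_iff_coprime m N).mpr h

theorem val_intCast_eq {N : ℕ} [NeZero N] {a : ℤ} (h0 : 0 ≤ a) (h1 : a < N) :
    ((a : ZMod N).val : ℤ) = a := by
  rw [ZMod.val_intCast, Int.emod_eq_of_lt h0 h1]

/-- The lattices of the theorem, scaled by `2 j`, give `j`-fold packings of the triangle with legs
`2 j`. -/
theorem packing_of_coprime {j m : ℕ} (hm : Nat.gcd m (2 * j + 1) = 1)
    (hm1 : Nat.gcd (m + 1) (2 * j + 1) = 1) (x : Plane) :
    ({v | v ∈ Submodule.span ℤ {((1, (m : ℝ)) : Plane), ((0, 2 * (j : ℝ) + 1) : Plane)} ∧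
      (0 < x.1 - v.1 ∧ 0 < x.2 - v.2 ∧ x.1 - v.1 + (x.2 - v.2) < 2 * j)} :
        Set Plane).encard ≤ j := by
  set A : ℤ := ⌈x.1⌉ - 1
  set B : ℤ := ⌈x.2⌉ - 1
  set c : ZMod (2 * j + 1) := (B : ZMod (2 * j + 1)) - m * (A : ZMod (2 * j + 1)) with hc
  -- the lattice point `(a, y)` is recorded by `A - a`, which is the abscissa of a point of the
  -- integral triangle below `(A, B)`
  have hkey : ∀ v : Plane,
      v ∈ Submodule.span ℤ {((1, (m : ℝ)) : Plane), ((0, 2 * (j : ℝ) + 1) : Plane)} →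
      0 < x.1 - v.1 → 0 < x.2 - v.2 → x.1 - v.1 + (x.2 - v.2) < 2 * j →
      ∃ a y : ℤ, v = ((a : ℝ), (y : ℝ)) ∧
        (((A - a : ℤ) : ZMod (2 * j + 1)).val : ℤ) = A - a ∧
        ((m * ((A - a : ℤ) : ZMod (2 * j + 1)) + c).val : ℤ) = B - y ∧
        (A - a) + (B - y) < 2 * j := by
    intro v hv h1 h2 h3
    obtain ⟨a, b, ha, hb⟩ := mem_span_one_zero.mp hv
    have hy : v.2 = ((a * m + b * (2 * j + 1) : ℤ) : ℝ) := by rw [hb]; push_cast; ring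
    set y : ℤ := a * m + b * (2 * j + 1) with hydef
    rw [ha] at h1 h3
    rw [hy] at h2 h3
    have ha' : a < ⌈x.1⌉ := Int.lt_ceil.mpr (by linarith)
    have hy' : y < ⌈x.2⌉ := Int.lt_ceil.mpr (by linarith)
    have hA : (A : ℝ) < x.1 := Int.lt_ceil.mp (by omega)
    have hB : (B : ℝ) < x.2 := Int.lt_ceil.mp (by omega)
    have hlt : (A - a) + (B - y) < 2 * (j : ℤ) := by
      have : ((A : ℝ) - a) + (B - y) < 2 * (j : ℝ) := by linarith
      exact_mod_cast this
    have hA0 : 0 ≤ A - a := by omega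
    have hB0 : 0 ≤ B - y := by omega
    refine ⟨a, y, Prod.ext ha hy, val_intCast_eq hA0 (by push_cast; omega), ?_, hlt⟩
    have hcong : (m : ZMod (2 * j + 1)) * ((A - a : ℤ) : ZMod (2 * j + 1)) + c
        = ((B - y : ℤ) : ZMod (2 * j + 1)) := by
      have hN : (2 * (j : ZMod (2 * j + 1)) + 1) = 0 := by
        exact_mod_cast ZMod.natCast_self (2 * j + 1)
      rw [hc, hydef]
      push_cast
      rw [hN]
      ring
    rw [hcong]
    exact val_intCast_eq hB0 (by push_cast; omega)
  have hmaps : ∀ v ∈ ({v | v ∈ Submodule.span ℤ {((1, (m : ℝ)) : Plane),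
      ((0, 2 * (j : ℝ) + 1) : Plane)} ∧
      (0 < x.1 - v.1 ∧ 0 < x.2 - v.2 ∧ x.1 - v.1 + (x.2 - v.2) < 2 * j)} : Set Plane),
      (fun v : Plane => ((A - ⌊v.1⌋ : ℤ) : ZMod (2 * j + 1))) v ∈
        ((Finset.univ.filter fun a : ZMod (2 * j + 1) => a.val + (m * a + c).val < 2 * j :
          Finset (ZMod (2 * j + 1))) : Set (ZMod (2 * j + 1))) := by
    rintro v ⟨hv, h1, h2, h3⟩
    obtain ⟨a, y, rfl, e1, e2, e3⟩ := hkey v hv h1 h2 h3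
    rw [Finset.mem_coe, Finset.mem_filter]
    simp only [Int.floor_intCast]
    exact ⟨Finset.mem_univ _, by omega⟩
  have hinj : Set.InjOn (fun v : Plane => ((A - ⌊v.1⌋ : ℤ) : ZMod (2 * j + 1)))
      {v | v ∈ Submodule.span ℤ {((1, (m : ℝ)) : Plane), ((0, 2 * (j : ℝ) + 1) : Plane)} ∧
      (0 < x.1 - v.1 ∧ 0 < x.2 - v.2 ∧ x.1 - v.1 + (x.2 - v.2) < 2 * j)} := by
    rintro v ⟨hv, h1, h2, h3⟩ w ⟨hw, k1, k2, k3⟩ hvw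
    obtain ⟨a, y, rfl, e1, e2, e3⟩ := hkey v hv h1 h2 h3
    obtain ⟨a', y', rfl, f1, f2, f3⟩ := hkey w hw k1 k2 k3
    simp only [Int.floor_intCast] at hvw
    rw [hvw] at e1 e2
    have h4 : a = a' := by omega
    have h5 : y = y' := by omega
    rw [h4, h5]
  refine (Set.encard_le_encard_of_injOn hmaps hinj).trans ?_
  rw [Set.encard_coe_eq_coe_finsetCard]
  exact_mod_cast card_filter_val_add_val_le (isUnit_of_gcd_eq_one hm)
    (by exact_mod_cast isUnit_of_gcd_eq_one hm1) c

/-! ### Scaling, and the packing density -/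

theorem HasCovolume.exists_smul {L : Submodule ℤ Plane} {D : ℝ} (hL : HasCovolume L D) {c : ℝ}
    (hc : 0 < c) :
    ∃ L' : Submodule ℤ Plane, HasCovolume L' (c ^ 2 * D) ∧ ∀ v, c • v ∈ L' ↔ v ∈ L := by
  obtain ⟨u, w, rfl, hD, hpos⟩ := hL
  refine ⟨_, ⟨c • u, c • w, rfl, ?_, by positivity⟩, fun v => ?_⟩
  · rw [← hD, ← abs_of_pos (pow_pos hc 2), ← abs_mul]
    congr 1
    simp only [Prod.smul_fst, Prod.smul_snd, smul_eq_mul]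
    ring
  · simp only [Submodule.mem_span_pair, smul_comm _ c, ← smul_add]
    constructor <;> rintro ⟨a, b, h⟩ <;> refine ⟨a, b, ?_⟩
    · exact smul_right_injective _ hc.ne' h
    · rw [h]

/-- Scaling the lattice by `c` replaces the unit triangle by the triangle with legs `c`. -/
theorem encard_triangle_smul {L L' : Submodule ℤ Plane} {c : ℝ} (hc : 0 < c)
    (h : ∀ v, c • v ∈ L' ↔ v ∈ L) (x : Plane) :
    ({v | v ∈ L' ∧ (0 < (c • x).1 - v.1 ∧ 0 < (c • x).2 - v.2 ∧
        (c • x).1 - v.1 + ((c • x).2 - v.2) < c)} : Set Plane).encard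
      = ({v | v ∈ L ∧ (0 < x.1 - v.1 ∧ 0 < x.2 - v.2 ∧ x.1 - v.1 + (x.2 - v.2) < 1)} :
        Set Plane).encard := by
  rw [← (smul_right_injective Plane hc.ne').encard_image
    ({v | v ∈ L ∧ (0 < x.1 - v.1 ∧ 0 < x.2 - v.2 ∧ x.1 - v.1 + (x.2 - v.2) < 1)} : Set Plane)]
  congr 1
  have hiff : ∀ v : Plane, (0 < (c • x).1 - (c • v).1 ∧ 0 < (c • x).2 - (c • v).2 ∧
      (c • x).1 - (c • v).1 + ((c • x).2 - (c • v).2) < c) ↔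
      (0 < x.1 - v.1 ∧ 0 < x.2 - v.2 ∧ x.1 - v.1 + (x.2 - v.2) < 1) := by
    intro v
    simp only [Prod.smul_fst, Prod.smul_snd, smul_eq_mul, ← mul_sub, ← mul_add]
    rw [mul_pos_iff_of_pos_left hc, mul_pos_iff_of_pos_left hc, mul_lt_iff_lt_one_right hc]
  ext v
  constructor
  · rintro ⟨hv, hx⟩
    have hv' : c • (c⁻¹ • v) = v := smul_inv_smul₀ hc.ne' v
    rw [← hv'] at hv hx
    exact ⟨c⁻¹ • v, ⟨(h _).mp hv, (hiff _).mp hx⟩, hv'⟩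
  · rintro ⟨w, ⟨hw, hx⟩, rfl⟩
    exact ⟨(h w).mpr hw, (hiff w).mpr hx⟩

theorem isFoldPacking_triangle_iff_smul {j : ℕ} {L L' : Submodule ℤ Plane} {c : ℝ} (hc : 0 < c)
    (h : ∀ v, c • v ∈ L' ↔ v ∈ L) :
    IsFoldPacking j (translates triangle L) ↔ ∀ x : Plane,
      ({v | v ∈ L' ∧ (0 < x.1 - v.1 ∧ 0 < x.2 - v.2 ∧ x.1 - v.1 + (x.2 - v.2) < c)} :
        Set Plane).encard ≤ j := by
  rw [isFoldPacking_triangle_iff]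
  constructor
  · intro hp x
    have := encard_triangle_smul hc h (c⁻¹ • x)
    rw [smul_inv_smul₀ hc.ne'] at this
    rw [this]
    exact hp _
  · intro hp x
    rw [← encard_triangle_smul hc h x]
    exact hp _

/-- The lattice of the theorem with parameter `m`. -/
def optimalLattice (j m : ℕ) : Submodule ℤ Plane :=
  Submodule.span ℤ
    {((1 / (2 * (j : ℝ)), (m : ℝ) / (2 * (j : ℝ))) : Plane),
      ((0, (2 * (j : ℝ) + 1) / (2 * (j : ℝ))) : Plane)}

theorem smul_mem_iff_mem_optimalLattice {j : ℕ} (hj : 1 ≤ j) (m : ℕ) (v : Plane) :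
    (2 * (j : ℝ)) • v ∈ Submodule.span ℤ {((1, (m : ℝ)) : Plane), ((0, 2 * (j : ℝ) + 1) : Plane)}
      ↔ v ∈ optimalLattice j m := by
  have hjR : (0 : ℝ) < 2 * j := by exact_mod_cast (by omega : 0 < 2 * j)
  have h1 : ((1, (m : ℝ)) : Plane)
      = (2 * (j : ℝ)) • ((1 / (2 * (j : ℝ)), (m : ℝ) / (2 * (j : ℝ))) : Plane) := by
    rw [Prod.smul_mk, smul_eq_mul, smul_eq_mul, mul_div_cancel₀ _ hjR.ne',
      mul_div_cancel₀ _ hjR.ne']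
  have h2 : ((0, 2 * (j : ℝ) + 1) : Plane)
      = (2 * (j : ℝ)) • ((0, (2 * (j : ℝ) + 1) / (2 * (j : ℝ))) : Plane) := by
    rw [Prod.smul_mk, smul_eq_mul, smul_eq_mul, mul_zero, mul_div_cancel₀ _ hjR.ne']
  rw [h1, h2, optimalLattice]
  simp only [Submodule.mem_span_pair, smul_comm _ (2 * (j : ℝ)), ← smul_add]
  exact exists_congr fun a => exists_congr fun b => (smul_right_injective Plane hjR.ne').eq_iff

theorem hasCovolume_optimalLattice {j : ℕ} (hj : 1 ≤ j) (m : ℕ) :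
    HasCovolume (optimalLattice j m) ((2 * j + 1) / (2 * j) ^ 2) := by
  have hjR : (0 : ℝ) < 2 * j := by exact_mod_cast (by omega : 0 < 2 * j)
  refine ⟨_, _, rfl, ?_, by positivity⟩
  simp only [mul_zero, sub_zero]
  rw [abs_of_pos (by positivity)]
  field_simp

theorem isFoldPacking_optimalLattice {j m : ℕ} (hj : 1 ≤ j) (hm : Nat.gcd m (2 * j + 1) = 1)
    (hm1 : Nat.gcd (m + 1) (2 * j + 1) = 1) :
    IsFoldPacking j (translates triangle (optimalLattice j m)) :=
  (isFoldPacking_triangle_iff_smul (by exact_mod_cast (by omega : 0 < 2 * j))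
    (smul_mem_iff_mem_optimalLattice hj m)).mpr (packing_of_coprime hm hm1)

/-- A `j`-fold lattice packing of the triangle has covolume at least `(2 j + 1) / (2 j) ^ 2`, with
equality only for the lattices of the theorem. -/
theorem HasCovolume.bound_of_isFoldPacking {Λ : Submodule ℤ Plane} {D : ℝ} (hΛ : HasCovolume Λ D)
    {j : ℕ} (hj : 1 ≤ j) (hpack : IsFoldPacking j (translates triangle Λ)) :
    (2 * (j : ℝ) + 1) / (2 * j) ^ 2 ≤ D ∧ (D = (2 * (j : ℝ) + 1) / (2 * j) ^ 2 →
      ∃ m : ℕ, 1 ≤ m ∧ m ≤ 2 * j + 1 ∧ Nat.gcd m (2 * j + 1) = 1 ∧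
        Nat.gcd (m + 1) (2 * j + 1) = 1 ∧ Λ = optimalLattice j m) := by
  have hjR : (0 : ℝ) < 2 * j := by exact_mod_cast (by omega : 0 < 2 * j)
  obtain ⟨L, hL, hmem⟩ := hΛ.exists_smul hjR
  obtain ⟨h1, h2⟩ := hL.bound_of_packing hj ((isFoldPacking_triangle_iff_smul hjR hmem).mp hpack)
  refine ⟨by rw [div_le_iff₀ (by positivity)]; linarith, ?_⟩
  intro hD
  have hLD : (2 * (j : ℝ)) ^ 2 * D = 2 * j + 1 := by
    rw [hD]; exact mul_div_cancel₀ _ (by positivity)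
  have hex := h2 hLD
  rw [hLD] at hL
  obtain ⟨m, hm1, hm2, hm3, hm4, hspan⟩ := hL.exists_nat_of_exact hj hex
  refine ⟨m, hm1, hm2, hm3, hm4, ?_⟩
  ext v
  rw [← hmem, hspan]
  exact smul_mem_iff_mem_optimalLattice hj m v

theorem HasCovolume.hasDensity_triangle {Λ : Submodule ℤ Plane} {D : ℝ} (hΛ : HasCovolume Λ D) :
    HasDensity (translates triangle Λ) (volume triangle / ENNReal.ofReal D) :=
  hΛ.hasDensity isBounded_triangle ⟨(0, 0), by rw [triangle_eq]; norm_num⟩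

theorem latticePackingDensity_triangle {j : ℕ} (hj : 1 ≤ j) :
    latticePackingDensity j triangle
      = volume triangle / ENNReal.ofReal ((2 * j + 1) / (2 * j) ^ 2) := by
  apply le_antisymm
  · refine iSup_le fun Λ => iSup_le fun hΛ => iSup_le fun hpack => ?_
    obtain ⟨D, hD⟩ := hΛ.exists_hasCovolume
    rw [hD.hasDensity_triangle.1]
    exact ENNReal.div_le_div_left
      (ENNReal.ofReal_le_ofReal (hD.bound_of_isFoldPacking hj hpack).1) _
  · have hcov := hasCovolume_optimalLattice hj 1
    have hpack : IsFoldPacking j (translates triangle (optimalLattice j 1)) :=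
      isFoldPacking_optimalLattice hj (Nat.gcd_one_left _) (by simp)
    rw [← hcov.hasDensity_triangle.1]
    exact le_iSup_of_le _ (le_iSup_of_le hcov.isPlaneLattice (le_iSup_of_le hpack le_rfl))

theorem theorem2 (j : ℕ) (hj : 1 ≤ j) (Λ : Submodule ℤ Plane) (hΛ : IsPlaneLattice Λ) :
    Λ ∈ optimalPackingLattices j triangle ↔
      ∃ m : ℕ, 1 ≤ m ∧ m ≤ 2 * j + 1 ∧
        Nat.gcd m (2 * j + 1) = 1 ∧ Nat.gcd (m + 1) (2 * j + 1) = 1 ∧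
        Λ = Submodule.span ℤ
          {((1 / (2 * (j : ℝ)), (m : ℝ) / (2 * (j : ℝ))) : Plane),
            ((0, (2 * (j : ℝ) + 1) / (2 * (j : ℝ))) : Plane)} := by
  constructor
  · rintro ⟨-, hpack, hdens⟩
    obtain ⟨D, hD⟩ := hΛ.exists_hasCovolume
    have h := hD.hasDensity_triangle.1.symm.trans hdens.1
    rw [latticePackingDensity_triangle hj, ENNReal.div_eq_inv_mul, ENNReal.div_eq_inv_mul,
      ENNReal.mul_left_inj volume_triangle_ne_zero isBounded_triangle.measure_lt_top.ne,
      inv_inj, ENNReal.ofReal_eq_ofReal_iff hD.pos.le (by positivity)] at h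
    exact (hD.bound_of_isFoldPacking hj hpack).2 h
  · rintro ⟨m, -, -, hm, hm1, rfl⟩
    refine ⟨hΛ, isFoldPacking_optimalLattice hj hm hm1, ?_⟩
    rw [latticePackingDensity_triangle hj]
    exact (hasCovolume_optimalLattice hj m).hasDensity_triangle
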